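/- All graphs are simple, and a connected graph is regarded as the metric space formed by its vertex set with the path metric. A metric space $X$ has $\mathrm{asdim}(X)\le n$ if every uniformly bounded open cover of $X$ refines some uniformly bounded open cover of $X$ in which every point lies in at most $n+1$ members; $\mathrm{asdim}(X)\in\mathbb N\cup\{\infty\}$ is the least such $n$. A group acts *quasi-transitively* on a graph if it acts by automorphisms with finitely many orbits of vertices; a graph is *quasi-transitive* if its automorphism group acts so. **Tree amalgamations.** Let $G_1,G_2$ be graphs, $I_1,I_2$ disjoint index sets, $(S^i_k)_{k\in I_i}$ families of subsets of $V(G_i)$ ($i=1,2$), all of the same cardinality, $\phi_{k\ell}\colon S^1_k\to S^2_\ell$ bijections ($k\in I_1$, $\ell\in I_2$), and $\phi_{\ell k}=\phi_{k\ell}^{-1}$. Let $T$ be a tree with bipartition $\{V_1,V_2\}$ whose directed edges are labelled by $f$ so that, for every $v\in V_i$, the edges starting at $v$ are labelled bijectively by $I_i$. Take a copy $G_v$ of $G_i$ for each $v\in V_i$ and, for every edge $\vec e=\vec{uv}$ of $T$ with $f(\vec e)=k$ and label $\ell$ of the reversed edge, join each $x$ in the copy of $S_k$ in $G_u$ to $\phi_{k\ell}(x)$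 in the copy of $S_\ell$ in $G_v$. Contracting all these new edges gives the *tree amalgamation* $G_1*_TG_2$; let $\pi$ be the contraction map on vertices. It is *trivial* if for some $v\in V(T)$ the restriction of $\pi$ to $V(G_v)$ is a bijection onto $V(G_1*_TG_2)$; it has *finite adhesion* if all sets $S^i_k$ are finite, and *finite identification* if there is a common bound, over all vertices $x$ of $G_1*_TG_2$, on the number of $v\in V(T)$ such that $x\in\pi(V(G_v))$. Let $\Gamma_i$ be a group acting on $G_i$ ($i=1,2$), and write $\{i,j\}=\{1,2\}$. The amalgamation *respects* $\Gamma_i$ if for every $\gamma\in\Gamma_i$ there is a permutation $\sigma$ of $I_i$ such that for every $k\in I_i$ there are $\ell\in I_j$ and $\tau\in\Gamma_j$ with $\tau(S_\ell)=S_\ell$ and $\phi_{k\ell}=\tau\circ\phi_{\sigma(k)\ell}\circ\gamma|_{S_k}$. The bonding maps between $J_i\subseteq I_i$ and $J_j\subseteq I_j$ are *consistent* if for all $k\in J_i$ and $\ell,\ell'\in J_j$ there is $\gamma\in\Gamma_j$ with $\phi_{k\ell}=\gamma\circ\phi_{k\ell'}$. The amalgamation *respects the actions* if it respects $\Gamma_1$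 and $\Gamma_2$ and either (Type 1) the bonding maps between $I_1$ and $I_2$ are consistent, or (Type 2) $G_1=G_2$, $\Gamma_1=\Gamma_2$ and $I_1=I_2=:I$ up to identification, and there is $J\subseteq I$ such that for every edge of $T$ exactly one of its two labels lies in $J$ and the bonding maps between $J$ and $I\setminus J$ are consistent (both for $J\subseteq I_1$, $I\setminus J\subseteq I_2$ and for $J\subseteq I_2$, $I\setminus J\subseteq I_1$). **Factorisations.** For locally finite quasi-transitive connected graphs, *factorisations* are defined recursively: $(G_1)$ is a factorisation of every graph isomorphic to $G_1$; if $(G_1,\dots,G_m)$ is a factorisation of $H_1$ and $(G_{m+1},\dots,G_n)$ is a factorisation of $H_2$, and $G$ is isomorphic to a non-trivial tree amalgamation of $H_1$ and $H_2$ of finite adhesion and finite identification that respects some quasi-transitive actions of groups on $H_1$ and $H_2$, then $(G_1,\dots,G_n)$, in any order, is a factorisation of $G$. Here $H_1$, $H_2$ and $G$ are locally finite, quasi-transitive and connected. **Theorem.** Let $(G_1,\dots,G_n)$ be a factorisation of a locally finite quasi-transitive connected graph $G$. Then $$\mathrm{asdim}(G)\le\max\{1,\ \mathrm{asdim}(G_i)\mid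 1\le i\le n\}.$$ -/

import Mathlib

universe u

noncomputable section

namespace TreeAmalg

/-! ### Asymptotic dimension of metric spaces -/

section Asdim

variable {X : Type u}

/-- `sup {diam V | V ∈ 𝒱}` is finite. -/
def UniformlyBounded [MetricSpace X] (𝒱 : Set (Set X)) : Prop :=
  ∃ D : ℝ, ∀ V ∈ 𝒱, ∀ x ∈ V, ∀ y ∈ V, dist x y ≤ D

/-- A uniformly bounded open cover of `X`. -/
structure IsBoundedOpenCover [MetricSpace X] (𝒱 : Set (Set X)) : Prop where
  isOpen : ∀ V ∈ 𝒱, IsOpen V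
  cover : ⋃₀ 𝒱 = Set.univ
  bounded : UniformlyBounded 𝒱

/-- Every point lies in at most `m` members of the family. -/
def MultiplicityLE (𝒱 : Set (Set X)) (m : ℕ) : Prop :=
  ∀ x : X, {V ∈ 𝒱 | x ∈ V}.encard ≤ m

/-- `𝒰` refines `𝒱`. -/
def Refines (𝒰 𝒱 : Set (Set X)) : Prop :=
  ∀ U ∈ 𝒰, ∃ V ∈ 𝒱, U ⊆ V

/-- `X` has asymptotic dimension at most `n`. -/
def AsdimLE (X : Type u) [MetricSpace X] (n : ℕ) : Prop :=
  ∀ 𝒱 : Set (Set X), IsBoundedOpenCover 𝒱 →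
    ∃ 𝒰 : Set (Set X), IsBoundedOpenCover 𝒰 ∧ MultiplicityLE 𝒰 (n + 1) ∧ Refines 𝒱 𝒰

/-- The asymptotic dimension, with value `⊤` if no finite bound exists. -/
def asdim (X : Type u) [MetricSpace X] : ℕ∞ :=
  ⨅ (n : ℕ) (_ : AsdimLE X n), (n : ℕ∞)

end Asdim

/-! ### Quasi-transitive graphs -/

section Graphs

variable {V : Type u}

/-- The vertex set of a connected graph with the path metric. -/
abbrev graphMetric (G : SimpleGraph V) (hG : G.Connected) : MetricSpace V where
  dist x y := (G.dist x y : ℝ)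
  dist_self x := by simp
  dist_comm x y := by rw [SimpleGraph.dist_comm]
  dist_triangle x y z := by exact_mod_cast hG.dist_triangle
  eq_of_dist_eq_zero := by
    intro x y h
    exact hG.dist_eq_zero_iff.mp (by exact_mod_cast h)

/-- A group of automorphisms of `G` with only finitely many orbits of vertices. -/
def ActsQuasiTransitively {G : SimpleGraph V} (Γ : Subgroup (G ≃g G)) : Prop :=
  ∃ F : Set V, F.Finite ∧ ∀ x : V, ∃ y ∈ F, ∃ γ ∈ Γ, γ y = x

end Graphs

/-- Locally finite quasi-transitive connected graphs. -/
structure QTGraph where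
  V : Type u
  graph : SimpleGraph V
  connected : graph.Connected
  locallyFinite : ∀ x : V, (graph.neighborSet x).Finite
  quasiTransitive : ActsQuasiTransitively (⊤ : Subgroup (graph ≃g graph))

/-- The asymptotic dimension of the vertex set with the path metric. -/
def QTGraph.asdim (G : QTGraph.{u}) : ℕ∞ :=
  @TreeAmalg.asdim G.V (graphMetric G.graph G.connected)

/-! ### Tree amalgamations -/

/-- The data of a tree amalgamation of `G₁` and `G₂`: families of subsets `S₁ k` of `V(G₁)` and
`S₂ ℓ` of `V(G₂)`, bonding maps `φ k ℓ`, a connecting tree with bipartition `T₁`, `T₂`, and a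
labelling of its directed edges. The labels of the edges that start at a node in `Tᵢ` are given as
a bijection from its neighbours to `Iᵢ`; in particular, such a node has degree `|Iᵢ|`. The bonding
maps force all sets `S₁ k`, `S₂ ℓ` to have the same cardinality. -/
structure TreeAmalgam {V₁ V₂ : Type u} (G₁ : SimpleGraph V₁) (G₂ : SimpleGraph V₂) where
  I₁ : Type u
  I₂ : Type u
  S₁ : I₁ → Set V₁
  S₂ : I₂ → Set V₂
  φ : ∀ (k : I₁) (ℓ : I₂), S₁ k ≃ S₂ ℓ
  T₁ : Type u
  T₂ : Type u
  tree : SimpleGraph (T₁ ⊕ T₂)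
  isTree : tree.IsTree
  not_adj_left : ∀ u u' : T₁, ¬ tree.Adj (Sum.inl u) (Sum.inl u')
  not_adj_right : ∀ v v' : T₂, ¬ tree.Adj (Sum.inr v) (Sum.inr v')
  /-- `label₁ u ⟨v, _⟩` is the label of the directed edge from `u` to `v`. -/
  label₁ : ∀ u : T₁, {v : T₂ // tree.Adj (Sum.inl u) (Sum.inr v)} ≃ I₁
  /-- `label₂ v ⟨u, _⟩` is the label of the directed edge from `v` to `u`. -/
  label₂ : ∀ v : T₂, {u : T₁ // tree.Adj (Sum.inl u) (Sum.inr v)} ≃ I₂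

namespace TreeAmalgam

variable {V₁ V₂ : Type u} {G₁ : SimpleGraph V₁} {G₂ : SimpleGraph V₂}

/-- The vertices of the disjoint union of copies of `G₁`, one for each node in `T₁`, and of copies
of `G₂`, one for each node in `T₂`. -/
abbrev Vert (A : TreeAmalgam G₁ G₂) : Type u := (A.T₁ × V₁) ⊕ (A.T₂ × V₂)

/-- The node of the connecting tree whose copy contains the given vertex. -/
def node (A : TreeAmalgam G₁ G₂) : A.Vert → A.T₁ ⊕ A.T₂ := Sum.map Prod.fst Prod.fst

/-- Two vertices in the same copy that are adjacent there. -/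
inductive CopyRel (A : TreeAmalgam G₁ G₂) : A.Vert → A.Vert → Prop
  | left (u : A.T₁) (x y : V₁) (h : G₁.Adj x y) : CopyRel A (Sum.inl (u, x)) (Sum.inl (u, y))
  | right (v : A.T₂) (x y : V₂) (h : G₂.Adj x y) : CopyRel A (Sum.inr (v, x)) (Sum.inr (v, y))

/-- For every edge `uv` of the connecting tree with labels `k` (from `u`) and `ℓ` (from `v`), each
`x` in the copy of `S₁ k` at `u` is related to `φ k ℓ x` in the copy of `S₂ ℓ` at `v`. -/
inductive BondRel (A : TreeAmalgam G₁ G₂) : A.Vert → A.Vert → Prop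
  | mk (u : A.T₁) (v : A.T₂) (h : A.tree.Adj (Sum.inl u) (Sum.inr v))
      (x : A.S₁ (A.label₁ u ⟨v, h⟩)) :
      BondRel A (Sum.inl (u, (x : V₁)))
        (Sum.inr (v, (A.φ (A.label₁ u ⟨v, h⟩) (A.label₂ v ⟨u, h⟩) x : V₂)))

/-- The disjoint union of all copies. -/
def copies (A : TreeAmalgam G₁ G₂) : SimpleGraph A.Vert := SimpleGraph.fromRel A.CopyRel

/-- The new edges between the copies. -/
def bonds (A : TreeAmalgam G₁ G₂) : SimpleGraph A.Vert := SimpleGraph.fromRel A.BondRel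

/-- The graph `G₁ + G₂`. -/
def sumGraph (A : TreeAmalgam G₁ G₂) : SimpleGraph A.Vert := A.copies ⊔ A.bonds

/-- The vertex set of the tree amalgamation, after contracting all new edges. -/
abbrev AmVert (A : TreeAmalgam G₁ G₂) : Type u := A.bonds.ConnectedComponent

/-- The contraction map. -/
def π (A : TreeAmalgam G₁ G₂) : A.Vert → A.AmVert := A.bonds.connectedComponentMk

/-- The tree amalgamation: `G₁ + G₂` with all new edges contracted (`SimpleGraph.map` discards the
resulting loops). -/
def graph (A : TreeAmalgam G₁ G₂) : SimpleGraph A.AmVert := A.sumGraph.map A.π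

/-- All adhesion sets are finite. -/
def FiniteAdhesion (A : TreeAmalgam G₁ G₂) : Prop :=
  (∀ k, (A.S₁ k).Finite) ∧ (∀ ℓ, (A.S₂ ℓ).Finite)

/-- For some node, the contraction map restricts to a bijection on the vertices of its copy. -/
def Trivial (A : TreeAmalgam G₁ G₂) : Prop :=
  (∃ u : A.T₁, Function.Bijective fun x : V₁ => A.π (Sum.inl (u, x))) ∨
  (∃ v : A.T₂, Function.Bijective fun x : V₂ => A.π (Sum.inr (v, x)))

/-- The nodes whose copy contains a vertex that is mapped to `x`. -/
def nodesOf (A : TreeAmalgam G₁ G₂) (x : A.AmVert) : Set (A.T₁ ⊕ A.T₂) :=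
  A.node '' (A.π ⁻¹' {x})

/-- The identification sizes of all vertices are bounded. -/
def FiniteIdentification (A : TreeAmalgam G₁ G₂) : Prop :=
  ∃ N : ℕ, ∀ x : A.AmVert, (A.nodesOf x).encard ≤ N

end TreeAmalgam

/-! ### Compatibility with group actions

A group acting on a graph enters only through its image in the automorphism group, so actions are
given as subgroups of the automorphism group. -/

section Actions

variable {V W I J : Type u} {G : SimpleGraph V} {H : SimpleGraph W}
  {S : I → Set V} {R : J → Set W}

/-- The bonding maps `φ k ℓ : S k → R ℓ` respect the automorphism `γ` of `G`, where `Δ` is the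
group acting on the other graph: for some permutation `σ` of the index set and every `k`, there are
`ℓ` and `τ ∈ Δ` stabilising `R ℓ` setwise with `φ k ℓ = τ ∘ φ (σ k) ℓ ∘ γ` on `S k`. -/
def RespectsElement (φ : ∀ k ℓ, S k ≃ R ℓ) (Δ : Subgroup (H ≃g H)) (γ : G ≃g G) : Prop :=
  ∃ σ : Equiv.Perm I, ∀ k : I, ∃ ℓ : J, ∃ τ ∈ Δ, τ '' R ℓ = R ℓ ∧
    ∀ x : S k, ∃ hx : γ x ∈ S (σ k), (φ k ℓ x : W) = τ (φ (σ k) ℓ ⟨γ x, hx⟩ : W)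

/-- The bonding maps respect every element of `Γ`. -/
def RespectsGroup (φ : ∀ k ℓ, S k ≃ R ℓ) (Γ : Subgroup (G ≃g G)) (Δ : Subgroup (H ≃g H)) : Prop :=
  ∀ γ ∈ Γ, RespectsElement φ Δ γ

/-- The bonding maps between `K ⊆ I` and `L ⊆ J` are consistent. -/
def Consistent (φ : ∀ k ℓ, S k ≃ R ℓ) (Δ : Subgroup (H ≃g H)) (K : Set I) (L : Set J) : Prop :=
  ∀ k ∈ K, ∀ ℓ ∈ L, ∀ ℓ' ∈ L, ∃ δ ∈ Δ, ∀ x : S k, (φ k ℓ x : W) = δ (φ k ℓ' x : W)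

end Actions

namespace TreeAmalgam

variable {V₁ V₂ : Type u} {G₁ : SimpleGraph V₁} {G₂ : SimpleGraph V₂}

/-- The bonding maps from the second side to the first one. -/
def φinv (A : TreeAmalgam G₁ G₂) (ℓ : A.I₂) (k : A.I₁) : A.S₂ ℓ ≃ A.S₁ k := (A.φ k ℓ).symm

/-- Both groups are respected. -/
def RespectsGroups (A : TreeAmalgam G₁ G₂) (Γ₁ : Subgroup (G₁ ≃g G₁)) (Γ₂ : Subgroup (G₂ ≃g G₂)) :
    Prop :=
  RespectsGroup A.φ Γ₁ Γ₂ ∧ RespectsGroup A.φinv Γ₂ Γ₁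

/-- Type 1 respecting the actions. -/
def IsType1 (A : TreeAmalgam G₁ G₂) (Γ₁ : Subgroup (G₁ ≃g G₁)) (Γ₂ : Subgroup (G₂ ≃g G₂)) : Prop :=
  A.RespectsGroups Γ₁ Γ₂ ∧ Consistent A.φ Γ₂ Set.univ Set.univ

/-- Type 2 respecting the actions. The identifications `G₁ = G₂`, `Γ₁ = Γ₂` and `I₁ = I₂` are
given by an isomorphism `e` that carries `Γ₁` to `Γ₂`, and by a bijection `b`. -/
def IsType2 (A : TreeAmalgam G₁ G₂) (Γ₁ : Subgroup (G₁ ≃g G₁)) (Γ₂ : Subgroup (G₂ ≃g G₂)) : Prop :=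
  ∃ (e : G₁ ≃g G₂) (b : A.I₁ ≃ A.I₂) (J : Set A.I₁),
    (∀ γ : G₁ ≃g G₁, γ ∈ Γ₁ ↔ (e.symm.trans (γ.trans e) : G₂ ≃g G₂) ∈ Γ₂) ∧
    (∀ (u : A.T₁) (v : A.T₂) (h : A.tree.Adj (Sum.inl u) (Sum.inr v)),
      A.label₁ u ⟨v, h⟩ ∈ J ↔ A.label₂ v ⟨u, h⟩ ∉ b '' J) ∧
    A.RespectsGroups Γ₁ Γ₂ ∧
    Consistent A.φ Γ₂ J (b '' J)ᶜ ∧ Consistent A.φinv Γ₁ (b '' J) Jᶜ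

/-- The tree amalgamation respects the actions of `Γ₁` and `Γ₂`. -/
def RespectsActions (A : TreeAmalgam G₁ G₂) (Γ₁ : Subgroup (G₁ ≃g G₁))
    (Γ₂ : Subgroup (G₂ ≃g G₂)) : Prop :=
  A.IsType1 Γ₁ Γ₂ ∨ A.IsType2 Γ₁ Γ₂

end TreeAmalgam

/-! ### Factorisations -/

/-- `G` is, up to isomorphism, a non-trivial tree amalgamation of `G₁` and `G₂` of finite adhesion
and finite identification that respects some quasi-transitive actions on `G₁` and `G₂`. -/
def IsAmalgamOf (G G₁ G₂ : QTGraph.{u}) : Prop :=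
  ∃ A : TreeAmalgam G₁.graph G₂.graph,
    ¬ A.Trivial ∧ A.FiniteAdhesion ∧ A.FiniteIdentification ∧
    (∃ (Γ₁ : Subgroup (G₁.graph ≃g G₁.graph)) (Γ₂ : Subgroup (G₂.graph ≃g G₂.graph)),
      ActsQuasiTransitively Γ₁ ∧ ActsQuasiTransitively Γ₂ ∧ A.RespectsActions Γ₁ Γ₂) ∧
    Nonempty (G.graph ≃g A.graph)

/-- The list `L` is a factorisation of `G`: `G` is obtained by iterated tree amalgamations of all
members of `L`, in any order and with any bracketing. -/
inductive IsFactorisation : List QTGraph.{u} → QTGraph.{u} → Prop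
  | single (G₁ G : QTGraph.{u}) (h : Nonempty (G.graph ≃g G₁.graph)) : IsFactorisation [G₁] G
  | amalgam (L₁ L₂ : List QTGraph.{u}) (G₁ G₂ G : QTGraph.{u})
      (h₁ : IsFactorisation L₁ G₁) (h₂ : IsFactorisation L₂ G₂) (h : IsAmalgamOf G G₁ G₂) :
      IsFactorisation (L₁ ++ L₂) G
  | perm (L L' : List QTGraph.{u}) (G : QTGraph.{u}) (hL : L.Perm L') (h : IsFactorisation L G) :
      IsFactorisation L' G

end TreeAmalg

end

namespace TreeAmalg

open Relation

section Colouring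

variable {V V' : Type u}

/-- Every scale `R` admits a colouring with `n + 1` colours whose monochromatic `R`-chains are
uniformly bounded. -/
def ColDimLE (G : SimpleGraph V) (n : ℕ) : Prop :=
  ∀ R : ℕ, ∃ (B : ℕ) (c : V → Fin (n + 1)), ∀ x y,
    ReflTransGen (fun a b => c a = c b ∧ G.dist a b ≤ R) x y → G.dist x y ≤ B

theorem reflTransGen_symm {α : Type*} {r : α → α → Prop} (h : ∀ a b, r a b → r b a) {x y : α}
    (hxy : ReflTransGen r x y) : ReflTransGen r y x := by
  induction hxy with
  | refl => exact .refl
  | tail _ hbc ih => exact .head (h _ _ hbc) ih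

theorem graphMetric_isOpen (G : SimpleGraph V) (hG : G.Connected) (U : Set V) :
    @IsOpen V (graphMetric G hG).toUniformSpace.toTopologicalSpace U := by
  let _ := graphMetric G hG
  rw [Metric.isOpen_iff]
  intro x hx
  refine ⟨1, one_pos, fun y hy => ?_⟩
  have h : (G.dist y x : ℝ) < 1 := hy
  have h0 : G.dist y x = 0 := by
    have : G.dist y x < 1 := by exact_mod_cast h
    omega
  rwa [hG.dist_eq_zero_iff.mp h0]

/-- The largest `m ≤ M` such that all points at distance less than `m` from `x` lie in `U`. -/
noncomputable def depthIn (G : SimpleGraph V) (M : ℕ) (U : Set V) (x : V) : ℕ :=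
  open Classical in Nat.findGreatest (fun m => ∀ y, G.dist x y < m → y ∈ U) M

theorem depthIn_spec (G : SimpleGraph V) (M : ℕ) (U : Set V) (x y : V)
    (h : G.dist x y < depthIn G M U x) : y ∈ U := by
  classical
  have := Nat.findGreatest_spec (P := fun m => ∀ y, G.dist x y < m → y ∈ U) (m := 0) (n := M)
    (Nat.zero_le _) (by simp)
  exact this y (by simpa [depthIn] using h)

theorem mem_of_depthIn_pos {G : SimpleGraph V} {M : ℕ} {U : Set V} {x : V}
    (h : 0 < depthIn G M U x) : x ∈ U :=
  depthIn_spec G M U x x (by simpa using h)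

theorem le_depthIn {G : SimpleGraph V} {M m : ℕ} {U : Set V} {x : V} (hm : m ≤ M)
    (h : ∀ y, G.dist x y < m → y ∈ U) : m ≤ depthIn G M U x := by
  classical
  exact Nat.le_findGreatest (P := fun m => ∀ y, G.dist x y < m → y ∈ U) hm h

theorem depthIn_le (G : SimpleGraph V) (M : ℕ) (U : Set V) (x : V) : depthIn G M U x ≤ M := by
  classical
  exact Nat.findGreatest_le M

theorem depthIn_le_add {G : SimpleGraph V} (hG : G.Connected) (M : ℕ) (U : Set V) (x y : V) :
    depthIn G M U x ≤ depthIn G M U y + G.dist x y := by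
  have h : depthIn G M U x - G.dist x y ≤ depthIn G M U y := by
    refine le_depthIn ((Nat.sub_le _ _).trans (depthIn_le G M U x)) fun z hz => ?_
    refine depthIn_spec G M U x z ?_
    have := hG.dist_triangle (u := x) (v := y) (w := z)
    omega
  omega

theorem ColDimLE.of_asdimLE {G : SimpleGraph V} (hG : G.Connected) {n : ℕ}
    (h : @AsdimLE V (graphMetric G hG) n) : ColDimLE G n := by
  intro R
  let _ := graphMetric G hG
  set g := R + 1 with hg
  set M := (n + 1) * g with hM
  have hMpos : 0 < M := by positivity
  obtain ⟨𝒰, hU, hmult, href⟩ := h (Set.range fun x => {y | G.dist x y < M}) {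
    isOpen := fun V _ => graphMetric_isOpen G hG V
    cover := by
      refine Set.eq_univ_of_forall fun x => ⟨_, ⟨x, rfl⟩, ?_⟩
      simpa using hMpos
    bounded := by
      refine ⟨2 * M, ?_⟩
      rintro _ ⟨z, rfl⟩ x hx y hy
      change (G.dist x y : ℝ) ≤ _
      have := hG.dist_triangle (u := x) (v := z) (w := y)
      rw [G.dist_comm (u := x) (v := z)] at this
      have h1 : G.dist z x < M := hx
      have h2 : G.dist z y < M := hy
      have h3 : G.dist x y ≤ 2 * M := by omega
      exact_mod_cast h3 }
  have htop : ∀ x, ∃ U ∈ 𝒰, depthIn G M U x = M := by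
    intro x
    obtain ⟨U, hU, hxU⟩ := href _ ⟨x, rfl⟩
    exact ⟨U, hU, le_antisymm (depthIn_le _ _ _ _) (le_depthIn le_rfl fun y hy => hxU hy)⟩
  have hgap : ∀ x, ∃ j : Fin (n + 1), ∀ U ∈ 𝒰,
      depthIn G M U x ≤ j * g ∨ (j + 1) * g ≤ depthIn G M U x := by
    intro x
    by_contra! hcon
    have hlev : ∀ j : Fin (n + 2), ∃ U ∈ 𝒰, x ∈ U ∧ depthIn G M U x / g = j := by
      intro j
      rcases Nat.lt_or_ge j (n + 1) with hj | hj
      · obtain ⟨U, hU, h1, h2⟩ := hcon ⟨j, hj⟩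
        refine ⟨U, hU, mem_of_depthIn_pos (pos_of_gt h1), ?_⟩
        exact Nat.div_eq_of_lt_le h1.le h2
      · obtain ⟨U, hU, h1⟩ := htop x
        refine ⟨U, hU, mem_of_depthIn_pos (h1 ▸ hMpos), ?_⟩
        rw [h1, hM, Nat.mul_div_cancel _ (Nat.succ_pos R)]
        omega
    choose u hu using hlev
    have hinj : Function.Injective u := by
      intro i j hij
      have := (hu i).2.2
      rw [hij, (hu j).2.2] at this
      exact Fin.ext this.symm
    have hsub : Set.range u ⊆ {V ∈ 𝒰 | x ∈ V} := by
      rintro _ ⟨j, rfl⟩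
      exact ⟨(hu j).1, (hu j).2.1⟩
    have := (Set.encard_le_encard hsub).trans (hmult x)
    rw [← Set.image_univ, hinj.encard_image, Set.encard_univ, ENat.card_eq_coe_fintype_card,
      Fintype.card_fin] at this
    have : n + 2 ≤ n + 1 := by exact_mod_cast this
    omega
  choose c hc using hgap
  obtain ⟨D, hD⟩ := hU.bounded
  refine ⟨⌈D⌉₊, c, fun x y hxy => ?_⟩
  obtain ⟨U, hUm, hUx⟩ := htop x
  have key : (c x + 1) * g ≤ depthIn G M U y ∧ c x = c y := by
    induction hxy with
    | refl =>
      refine ⟨?_, rfl⟩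
      rw [hUx]
      exact Nat.mul_le_mul_right _ (by omega)
    | @tail a b _ hab ih =>
      refine ⟨?_, ih.2.trans hab.1⟩
      rcases hc b U hUm with h | h
      · exfalso
        have h1 := depthIn_le_add hG M U a b
        have h2 := ih.1
        rw [ih.2, hab.1, add_mul] at h2
        omega
      · rwa [ih.2, hab.1]
  have hyU : y ∈ U := mem_of_depthIn_pos (lt_of_lt_of_le (by positivity) key.1)
  have hxU : x ∈ U := mem_of_depthIn_pos (hUx ▸ hMpos)
  have h : (G.dist x y : ℝ) ≤ D := hD U hUm x hxU y hyU
  exact_mod_cast h.trans (Nat.le_ceil D)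

theorem ColDimLE.asdimLE {G : SimpleGraph V} (hG : G.Connected) {n : ℕ}
    (h : ColDimLE G n) : @AsdimLE V (graphMetric G hG) n := by
  let _ := graphMetric G hG
  intro 𝒱 h𝒱
  obtain ⟨D, hD⟩ := h𝒱.bounded
  set d := ⌈D⌉₊ with hd
  obtain ⟨B, c, hc⟩ := h (2 * d)
  set r : V → V → Prop := fun a b => c a = c b ∧ G.dist a b ≤ 2 * d with hr
  have hsymm : ∀ {x y}, ReflTransGen r x y → ReflTransGen r y x := by
    intro x y hxy
    refine reflTransGen_symm (fun a b hab => ?_) hxy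
    exact ⟨hab.1.symm, by rw [G.dist_comm]; exact hab.2⟩
  let N : V → Set V := fun x => {z | ∃ y, ReflTransGen r x y ∧ G.dist y z ≤ d}
  have hNeq : ∀ {x y}, ReflTransGen r x y → N x = N y := by
    intro x y hxy
    ext z
    exact ⟨fun ⟨w, h1, h2⟩ => ⟨w, (hsymm hxy).trans h1, h2⟩,
      fun ⟨w, h1, h2⟩ => ⟨w, hxy.trans h1, h2⟩⟩
  refine ⟨Set.range N, ⟨fun V _ => graphMetric_isOpen G hG V, ?_, ?_⟩, ?_, ?_⟩
  · exact Set.eq_univ_of_forall fun x => ⟨N x, ⟨x, rfl⟩, x, .refl, by simp⟩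
  · refine ⟨(B + 2 * d : ℕ), ?_⟩
    rintro _ ⟨x, rfl⟩ y ⟨y', hy, hy'⟩ z ⟨z', hz, hz'⟩
    change (G.dist y z : ℝ) ≤ _
    have h1 := hc y' z' ((hsymm hy).trans hz)
    have h2 := hG.dist_triangle (u := y) (v := y') (w := z)
    have h3 := hG.dist_triangle (u := y') (v := z') (w := z)
    rw [G.dist_comm (u := y) (v := y')] at h2
    have h4 : G.dist y z ≤ B + 2 * d := by omega
    exact_mod_cast h4
  · intro x
    have hex : ∀ U : Set V, ∃ y, U ∈ Set.range N → x ∈ U → U = N y ∧ G.dist y x ≤ d := by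
      intro U
      by_cases hU : U ∈ Set.range N ∧ x ∈ U
      · obtain ⟨⟨z, rfl⟩, y, hy, hyx⟩ := hU
        exact ⟨y, fun _ _ => ⟨hNeq hy, hyx⟩⟩
      · exact ⟨x, fun h1 h2 => absurd ⟨h1, h2⟩ hU⟩
    choose y hy using hex
    have hinj : Set.InjOn (fun U => c (y U)) {V ∈ Set.range N | x ∈ V} := by
      intro U hU U' hU' hcol
      obtain ⟨h1, h2⟩ := hy U hU.1 hU.2
      obtain ⟨h1', h2'⟩ := hy U' hU'.1 hU'.2
      have h3 := hG.dist_triangle (u := y U) (v := x) (w := y U')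
      rw [G.dist_comm (u := x) (v := y U')] at h3
      rw [h1, h1']
      exact hNeq (.single ⟨hcol, by omega⟩)
    have := Set.encard_le_encard_of_injOn (t := (Set.univ : Set (Fin (n + 1))))
      (fun _ _ => Set.mem_univ _) hinj
    simpa using this
  · intro U hU
    rcases U.eq_empty_or_nonempty with rfl | ⟨x, hx⟩
    · obtain ⟨x⟩ := hG.nonempty
      exact ⟨N x, ⟨x, rfl⟩, Set.empty_subset _⟩
    · refine ⟨N x, ⟨x, rfl⟩, fun z hz => ⟨x, .refl, ?_⟩⟩
      have h : (G.dist x z : ℝ) ≤ D := hD U hU x hx z hz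
      exact_mod_cast h.trans (Nat.le_ceil D)

theorem ColDimLE.mono {G : SimpleGraph V} {m n : ℕ} (hmn : m ≤ n) (h : ColDimLE G m) :
    ColDimLE G n := by
  intro R
  obtain ⟨B, c, hc⟩ := h R
  refine ⟨B, fun x => Fin.castLE (by omega) (c x), fun x y hxy => hc x y ?_⟩
  exact ReflTransGen.mono (fun a b hab => ⟨Fin.castLE_injective _ hab.1, hab.2⟩) _ _ hxy

theorem edist_map_le {G : SimpleGraph V} {G' : SimpleGraph V'} (f : G →g G') (x y : V) :
    G'.edist (f x) (f y) ≤ G.edist x y :=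
  le_iInf fun w => (SimpleGraph.edist_le (w.map f)).trans_eq (by simp)

theorem dist_iso {G : SimpleGraph V} {G' : SimpleGraph V'} (e : G ≃g G') (x y : V) :
    G'.dist (e x) (e y) = G.dist x y := by
  refine congrArg ENat.toNat (le_antisymm (edist_map_le e.toHom x y) ?_)
  simpa using edist_map_le e.symm.toHom (e x) (e y)

theorem ColDimLE.of_iso {G : SimpleGraph V} {G' : SimpleGraph V'} (e : G ≃g G') {n : ℕ}
    (h : ColDimLE G' n) : ColDimLE G n := by
  intro R
  obtain ⟨B, c, hc⟩ := h R
  refine ⟨B, fun x => c (e x), fun x y hxy => ?_⟩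
  rw [← dist_iso e]
  refine hc _ _ (ReflTransGen.lift e (fun a b hab => ⟨hab.1, ?_⟩) _ _ hxy)
  rw [dist_iso e]
  exact hab.2

theorem asdim_le_of_colDimLE {G : QTGraph.{u}} {n : ℕ} (h : ColDimLE G.graph n) :
    G.asdim ≤ n := by
  let _ := graphMetric G.graph G.connected
  exact iInf₂_le n (h.asdimLE G.connected)

theorem ColDimLE.of_asdim_le {G : QTGraph.{u}} {n : ℕ} (h : G.asdim ≤ n) :
    ColDimLE G.graph n := by
  let _ := graphMetric G.graph G.connected
  by_contra hcon
  have hle : ((n + 1 : ℕ) : ℕ∞) ≤ G.asdim := by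
    refine le_iInf₂ fun m hm => ?_
    by_contra hlt
    have : m ≤ n := by
      have : m < n + 1 := by exact_mod_cast not_le.mp hlt
      omega
    exact hcon ((ColDimLE.of_asdimLE G.connected hm).mono this)
  have : n + 1 ≤ n := by exact_mod_cast hle.trans h
  omega

end Colouring

section RootedLayout

variable {V N : Type u}

theorem exists_recursive {α β : Type*} (μ : α → ℕ) (f : α → α) (g : α → β → β) (b : α → β) :
    ∃ a : α → β, ∀ z, (μ (f z) < μ z → a z = g z (a (f z))) ∧ (¬ μ (f z) < μ z → a z = b z) := by
  classical
  let F : ∀ z, (∀ y, μ y < μ z → β) → β := fun z rec =>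
    if h : μ (f z) < μ z then g z (rec (f z) h) else b z
  have wf : WellFounded (fun y z => μ y < μ z) := (measure μ).wf
  refine ⟨wf.fix F, fun z => ⟨fun h => ?_, fun h => ?_⟩⟩
  · rw [wf.fix_eq]
    exact dif_pos h
  · rw [wf.fix_eq]
    exact dif_neg h

/-- `w` is an ancestor of `u`, or `u` itself, for the parent map `p`. -/
def Anc (depth : N → ℕ) (p : N → N) (w u : N) : Prop :=
  ReflTransGen (fun a b => depth a = depth b + 1 ∧ p a = b) u w

namespace Anc

variable {depth : N → ℕ} {p : N → N}

theorem depth_le {w u : N} (h : Anc depth p w u) : depth w ≤ depth u := by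
  unfold Anc at h
  induction h with
  | refl => exact le_rfl
  | tail _ hbc ih => have := hbc.1; omega

theorem eq_of_depth_le {w u : N} (h : Anc depth p w u) (hd : depth u ≤ depth w) : w = u := by
  rcases ReflTransGen.cases_head h with h | ⟨v, huv, hvw⟩
  · exact h.symm
  · have := huv.1
    have := depth_le hvw
    omega

theorem antisymm {w u : N} (h : Anc depth p w u) (h' : Anc depth p u w) : w = u :=
  h.eq_of_depth_le h'.depth_le

theorem trans {w u v : N} (h : Anc depth p w u) (h' : Anc depth p u v) : Anc depth p w v :=
  ReflTransGen.trans h' h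

theorem eq_or_parent {w u : N} (h : Anc depth p w u) :
    w = u ∨ depth u = depth (p u) + 1 ∧ Anc depth p w (p u) := by
  rcases ReflTransGen.cases_head h with h | ⟨v, huv, hvw⟩
  · exact .inl h.symm
  · rw [← huv.2] at hvw huv
    exact .inr ⟨huv.1, hvw⟩

end Anc

/-- A graph `G` laid out along a rooted tree: every vertex `x` has a home node `t x`, and `S w`
separates the vertices whose home lies below `w` from all others. -/
structure IsRootedLayout (G : SimpleGraph V) (depth : N → ℕ) (p : N → N) (t : V → N)
    (S : N → Set V) (D : ℕ) : Prop where
  depth_parent : ∀ w, depth w ≠ 0 → depth w = depth (p w) + 1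
  root_empty : ∀ w, depth w = 0 → S w = ∅
  mem_parent : ∀ w, ∀ s ∈ S w, t s = p w ∨ s ∈ S (p w)
  separates : ∀ w x y, Anc depth p w (t x) → ¬ Anc depth p w (t y) →
    ∃ s ∈ S w, G.dist x s + G.dist s y ≤ G.dist x y
  diam_le : ∀ w, ∀ s ∈ S w, ∀ s' ∈ S w, G.dist s s' ≤ D

/-- The node `m w` is the lowest ancestor of `w` that is an anchor, where a node is an anchor if it
is the root or its separator has distance at least `K` from that of the next anchor above it. -/
structure IsAnchorMap (G : SimpleGraph V) (depth : N → ℕ) (p : N → N) (S : N → Set V) (K : ℕ)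
    (m : N → N) : Prop where
  root : ∀ w, depth w = 0 → m w = w
  far : ∀ w, depth w ≠ 0 → (∀ s ∈ S w, ∀ s' ∈ S (m (p w)), K ≤ G.dist s s') → m w = w
  near : ∀ w, depth w ≠ 0 → (∃ s ∈ S w, ∃ s' ∈ S (m (p w)), G.dist s s' < K) → m w = m (p w)

theorem exists_isAnchorMap (G : SimpleGraph V) (depth : N → ℕ) (p : N → N) (S : N → Set V) (K : ℕ)
    (hp : ∀ w, depth w ≠ 0 → depth w = depth (p w) + 1) :
    ∃ m, IsAnchorMap G depth p S K m := by
  classical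
  obtain ⟨m, hm⟩ := exists_recursive depth p
    (fun w a => if depth w ≠ 0 ∧ ∃ s ∈ S w, ∃ s' ∈ S a, G.dist s s' < K then a else w) id
  refine ⟨m, fun w hw => (hm w).2 (by omega), fun w hw h => ?_, fun w hw h => ?_⟩
  · rw [(hm w).1 (by have := hp w hw; omega), if_neg]
    rintro ⟨_, s, hs, s', hs', hlt⟩
    have := h s hs s' hs'
    omega
  · rw [(hm w).1 (by have := hp w hw; omega), if_pos ⟨hw, h⟩]

section Anchor

variable {G : SimpleGraph V} {depth : N → ℕ} {p : N → N} {t : V → N} {S : N → Set V} {D K : ℕ}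
  {m : N → N}

namespace IsAnchorMap

theorem eq_or_eq_parent (hm : IsAnchorMap G depth p S K m) (w : N) :
    m w = w ∨ depth w ≠ 0 ∧ m w = m (p w) ∧ ∃ s ∈ S w, ∃ s' ∈ S (m w), G.dist s s' < K := by
  by_cases hw : depth w = 0
  · exact .inl (hm.root w hw)
  by_cases h : ∃ s ∈ S w, ∃ s' ∈ S (m (p w)), G.dist s s' < K
  · have := hm.near w hw h
    exact .inr ⟨hw, this, this ▸ h⟩
  · push Not at h
    exact .inl (hm.far w hw h)

theorem anc (hm : IsAnchorMap G depth p S K m) (hL : IsRootedLayout G depth p t S D) (w : N) :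
    Anc depth p (m w) w ∧ m (m w) = m w := by
  induction hk : depth w generalizing w with
  | zero => rw [hm.root w hk, hm.root w hk]; exact ⟨.refl, rfl⟩
  | succ k ih =>
    rcases hm.eq_or_eq_parent w with h | ⟨h0, h, -⟩
    · rw [h, h]; exact ⟨.refl, rfl⟩
    · have hd := hL.depth_parent w h0
      obtain ⟨h1, h2⟩ := ih (p w) (by omega)
      rw [h]
      exact ⟨.head ⟨hd, rfl⟩ h1, h2⟩

theorem anc_of_anchor (hm : IsAnchorMap G depth p S K m)
    {b w : N} (hb : m b = b) (hbw : Anc depth p b w) : Anc depth p b (m w) := by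
  induction hk : depth w generalizing w with
  | zero => rwa [hm.root w hk]
  | succ k ih =>
    rcases hm.eq_or_eq_parent w with h | ⟨h0, h, -⟩
    · rwa [h]
    · rcases hbw.eq_or_parent with rfl | ⟨h1, h2⟩
      · rw [hb]; exact .refl
      · rw [h]; exact ih h2 (by omega)

theorem separates (hm : IsAnchorMap G depth p S K m) (hL : IsRootedLayout G depth p t S D)
    (x y : V) (h : m (t x) ≠ m (t y)) :
    (∃ s ∈ S (m (t x)), G.dist x s + G.dist s y ≤ G.dist x y) ∨
    (∃ s ∈ S (m (t y)), G.dist x s + G.dist s y ≤ G.dist x y) := by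
  obtain ⟨hx, hx'⟩ := hm.anc hL (t x)
  obtain ⟨hy, hy'⟩ := hm.anc hL (t y)
  by_cases h1 : Anc depth p (m (t x)) (t y)
  · by_cases h2 : Anc depth p (m (t y)) (t x)
    · exact absurd ((hm.anc_of_anchor hx' h1).antisymm (hm.anc_of_anchor hy' h2)) h
    · obtain ⟨s, hs, hd⟩ := hL.separates _ y x hy h2
      refine .inr ⟨s, hs, ?_⟩
      rw [G.dist_comm (u := x) (v := s), G.dist_comm (u := s) (v := y),
        G.dist_comm (u := x) (v := y)]
      omega
  · exact .inl (hL.separates _ x y hx h1)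

theorem mem_or_anchor_eq (hm : IsAnchorMap G depth p S K m) (hL : IsRootedLayout G depth p t S D)
    (w : N) (s : V) (hs : t s = w ∨ s ∈ S w) : m (t s) = m w ∨ s ∈ S (m w) := by
  induction hk : depth w generalizing w with
  | zero =>
    rcases hs with rfl | hs
    · exact .inl rfl
    · rw [hL.root_empty w hk] at hs
      exact hs.elim
  | succ k ih =>
    rcases hs with rfl | hs
    · exact .inl rfl
    · rcases hm.eq_or_eq_parent w with h | ⟨h0, h, -⟩
      · rw [h]; exact .inr hs
      · rw [h]
        exact ih (p w) (hL.mem_parent w s hs) (by have := hL.depth_parent w h0; omega)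

theorem separator_of_anchor (hm : IsAnchorMap G depth p S K m)
    (hL : IsRootedLayout G depth p t S D) (hK : 0 < K) {z : N} (hz : m z = z) {s : V}
    (hs : s ∈ S z) : depth (m (p z)) < depth z ∧ m (t s) = m (p z) ∧
      ∀ s' ∈ S (m (p z)), K ≤ G.dist s s' := by
  have h0 : depth z ≠ 0 := fun h => by
    rw [hL.root_empty z h] at hs
    exact hs
  have hd := hL.depth_parent z h0
  have hle := (hm.anc hL (p z)).1.depth_le
  have hfar : ∀ s ∈ S z, ∀ s' ∈ S (m (p z)), K ≤ G.dist s s' := by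
    by_contra! hcon
    have := hm.near z h0 hcon
    rw [hz] at this
    rw [← this] at hle
    omega
  refine ⟨by omega, ?_, hfar s hs⟩
  rcases hm.mem_or_anchor_eq hL (p z) s (hL.mem_parent z s hs) with h | h
  · exact h
  · have := hfar s hs s h
    rw [SimpleGraph.dist_self] at this
    omega

/-- Two vertices with the same anchor and distance at most `R`, both far from the separator
of the anchor, have the same home. -/
theorem home_eq (hm : IsAnchorMap G depth p S K m) (hL : IsRootedLayout G depth p t S D)
    (hG : G.Connected) {x y : V} {R L : ℕ} (hxy : m (t x) = m (t y)) (hR : G.dist x y ≤ R)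
    (hLK : R + D + K ≤ L) (hx : ∀ s ∈ S (m (t x)), L < G.dist x s)
    (hy : ∀ s ∈ S (m (t x)), L < G.dist y s) : t x = t y := by
  have key : ∀ x y, m (t x) = m (t y) → G.dist x y ≤ R → (∀ s ∈ S (m (t x)), L < G.dist x s) →
      Anc depth p (t x) (t y) := by
    intro x y hxy hR hx
    by_contra hcon
    obtain ⟨s, hs, hd⟩ := hL.separates (t x) x y .refl hcon
    rcases hm.eq_or_eq_parent (t x) with h | ⟨-, h, s1, hs1, s2, hs2, hlt⟩
    · have := hx s (by rwa [h])
      omega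
    · have h1 := hx s2 hs2
      have h2 := hL.diam_le _ s hs s1 hs1
      have h3 := hG.dist_triangle (u := x) (v := s) (w := s2)
      have h4 := hG.dist_triangle (u := s) (v := s1) (w := s2)
      omega
  refine (key x y hxy hR hx).antisymm (key y x hxy.symm (by rwa [G.dist_comm]) ?_)
  rwa [← hxy]

end IsAnchorMap

end Anchor

/-- A graph laid out along a rooted tree has asymptotic dimension at most `n ≥ 1` if the sets of
vertices with the same home have, uniformly. -/
theorem IsRootedLayout.colDimLE {G : SimpleGraph V} {depth : N → ℕ} {p : N → N} {t : V → N}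
    {S : N → Set V} {D : ℕ} (hL : IsRootedLayout G depth p t S D) (hG : G.Connected) {n : ℕ}
    (hn : 1 ≤ n)
    (hcol : ∀ R : ℕ, ∃ (B : ℕ) (c : V → Fin (n + 1)), ∀ x y,
      ReflTransGen (fun a b => t a = t b ∧ c a = c b ∧ G.dist a b ≤ R) x y → G.dist x y ≤ B) :
    ColDimLE G n := by
  classical
  intro R
  set K := 2 * R + 1 with hK
  set E := R + D with hE
  set R' := R + 2 * E with hR'
  set L := R' + D + K with hLdef
  obtain ⟨B, c, hc⟩ := hcol R'
  obtain ⟨m, hm⟩ := exists_isAnchorMap G depth p S K hL.depth_parent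
  have hK0 : 0 < K := by omega
  have : Nontrivial (Fin (n + 1)) := Fin.nontrivial_iff_two_le.mpr (by omega)
  choose other hother using fun i : Fin (n + 1) => exists_ne i
  have hpt : ∀ z, ∃ s, (S z).Nonempty → s ∈ S z := by
    intro z
    by_cases h : (S z).Nonempty
    · exact ⟨h.some, fun _ => h.some_mem⟩
    · exact ⟨hG.nonempty.some, fun h' => absurd h' h⟩
  choose pt hpt using hpt
  let within : ℕ → V → Prop := fun r x => ∃ s ∈ S (m (t x)), G.dist x s ≤ r
  -- the colours of the cores
  obtain ⟨a, ha⟩ := exists_recursive depth (fun z => m (p z))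
    (fun z b => if within L (pt z) then other b else c (pt z)) (fun _ => 0)
  let col : V → Fin (n + 1) := fun x =>
    if within R x then a (m (t x)) else if within L x then other (a (m (t x))) else c x
  have hpt_spec : ∀ x, within R x → m (t (pt (m (t x)))) = m (p (m (t x))) ∧
      ¬ within R (pt (m (t x))) ∧ col (pt (m (t x))) = a (m (t x)) ∧
      G.dist x (pt (m (t x))) ≤ E := by
    rintro x ⟨s, hs, hxs⟩
    have hs' := hpt _ ⟨s, hs⟩
    obtain ⟨h1, h2, h3⟩ := hm.separator_of_anchor hL hK0 (hm.anc hL (t x)).2 hs'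
    have hcore : ¬ within R (pt (m (t x))) := by
      rintro ⟨s1, hs1, hd⟩
      rw [h2] at hs1
      have := h3 s1 hs1
      omega
    refine ⟨h2, hcore, ?_, ?_⟩
    · simp only [col]
      rw [if_neg hcore, (ha _).1 h1, h2]
    · have := hL.diam_le _ s hs _ hs'
      have := hG.dist_triangle (u := x) (v := s) (w := pt (m (t x)))
      omega
  let η : V → N := fun x => if within R x then m (p (m (t x))) else m (t x)
  let ρ : V → V := fun x => if within R x then pt (m (t x)) else x
  have hρ : ∀ x, m (t (ρ x)) = η x ∧ ¬ within R (ρ x) ∧ col (ρ x) = col x ∧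
      G.dist x (ρ x) ≤ E := by
    intro x
    by_cases h : within R x
    · obtain ⟨h1, h2, h3, h4⟩ := hpt_spec x h
      simp only [ρ, η, if_pos h]
      refine ⟨h1, h2, ?_, h4⟩
      rw [h3]
      simp only [col, if_pos h]
    · simp only [ρ, η, if_neg h]
      simp [h]
  -- a short monochromatic step stays in the same piece
  have hfar : ∀ x y, (∀ s ∈ S (m (t x)), K ≤ G.dist x s) → (∀ s ∈ S (m (t y)), K ≤ G.dist y s) →
      G.dist x y ≤ R → m (t x) = m (t y) := by
    intro x y hx hy hd
    by_contra hne
    rcases hm.separates hL x y hne with ⟨s, hs, h⟩ | ⟨s, hs, h⟩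
    · have := hx s hs
      omega
    · have := hy s hs
      rw [G.dist_comm (u := y) (v := s)] at this
      omega
  have hcross : ∀ x y, G.dist x y ≤ R →
      (∃ s ∈ S (m (t x)), G.dist x s + G.dist s y ≤ G.dist x y) → η x = η y := by
    rintro x y hd ⟨s, hs, hxs⟩
    have hcx : within R x := ⟨s, hs, by omega⟩
    obtain ⟨-, h2, h3⟩ := hm.separator_of_anchor hL hK0 (hm.anc hL (t x)).2 hs
    have hηx : η x = m (t s) := by
      simp only [η, if_pos hcx, h2]
    rw [← h2] at h3
    rw [hηx]
    by_cases hsy : m (t s) = m (t y)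
    · have : ¬ within R y := by
        rintro ⟨s', hs', hd'⟩
        have h4 := h3 s' (hsy ▸ hs')
        have h5 := hG.dist_triangle (u := s) (v := y) (w := s')
        omega
      simp only [η, if_neg this, hsy]
    · rcases hm.separates hL s y hsy with ⟨s', hs', h⟩ | ⟨s', hs', h⟩
      · have := h3 s' hs'
        omega
      · have hcy : within R y := ⟨s', hs', by rw [G.dist_comm]; omega⟩
        obtain ⟨-, h2', h3'⟩ := hm.separator_of_anchor hL hK0 (hm.anc hL (t y)).2 hs'
        rw [← h2'] at h3'
        simp only [η, if_pos hcy]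
        rw [← h2']
        exact hfar s s' h3 h3' (by omega)
  have hstep : ∀ x y, col x = col y → G.dist x y ≤ R → η x = η y := by
    intro x y hcxy hd
    by_cases hxy : m (t x) = m (t y)
    · have key : ∀ x y, m (t x) = m (t y) → G.dist x y ≤ R → within R x → ¬ within R y →
          col x ≠ col y := by
        rintro x y hxy hd hx hy
        have hyL : within L y := by
          obtain ⟨s, hs, h⟩ := hx
          refine ⟨s, hxy ▸ hs, ?_⟩
          have := hG.dist_triangle (u := y) (v := x) (w := s)
          rw [G.dist_comm (u := y) (v := x)] at this
          omega
        simp only [col, if_pos hx, if_neg hy, if_pos hyL, ← hxy]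
        exact (hother _).symm
      by_cases hx : within R x <;> by_cases hy : within R y
      · simp only [η, if_pos hx, if_pos hy, hxy]
      · exact absurd hcxy (key x y hxy hd hx hy)
      · exact absurd hcxy.symm (key y x hxy.symm (by rwa [G.dist_comm]) hy hx)
      · simp only [η, if_neg hx, if_neg hy, hxy]
    · rcases hm.separates hL x y hxy with h | ⟨s, hs, h⟩
      · exact hcross x y hd h
      · refine (hcross y x (by rwa [G.dist_comm]) ⟨s, hs, ?_⟩).symm
        rw [G.dist_comm (u := y) (v := s), G.dist_comm (u := s) (v := x),
          G.dist_comm (u := y) (v := x)]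
        omega
  -- chains outside the cores
  let r : V → V → Prop := fun x y =>
    m (t x) = m (t y) ∧ ¬ within R x ∧ ¬ within R y ∧ col x = col y ∧ G.dist x y ≤ R'
  let good : V → V → Prop := fun a b => t a = t b ∧ c a = c b ∧ G.dist a b ≤ R'
  have hchain : ∀ x y, ReflTransGen r x y → m (t x) = m (t y) ∧
      (ReflTransGen good x y ∨ ∃ z, (∃ s ∈ S (m (t y)), G.dist z s ≤ L + R') ∧
        ReflTransGen good z y) := by
    intro x y hxy
    induction hxy with
    | refl => exact ⟨rfl, .inl .refl⟩
    | @tail y y' _ hyy ih =>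
      obtain ⟨h1, h2, h3, h4, h5⟩ := hyy
      refine ⟨ih.1.trans h1, ?_⟩
      by_cases hnear : ∃ s ∈ S (m (t y')), G.dist y' s ≤ L + R'
      · exact .inr ⟨y', hnear, .refl⟩
      push Not at hnear
      have hy : ∀ s ∈ S (m (t y)), L < G.dist y s := by
        intro s hs
        have := hnear s (h1 ▸ hs)
        have := hG.dist_triangle (u := y') (v := y) (w := s)
        rw [G.dist_comm (u := y') (v := y)] at this
        omega
      have hy' : ∀ s ∈ S (m (t y)), L < G.dist y' s := by
        intro s hs
        have := hnear s (h1 ▸ hs)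
        omega
      have ht := hm.home_eq hL hG h1 h5 le_rfl hy hy'
      have hgood : good y y' := by
        refine ⟨ht, ?_, h5⟩
        have n1 : ¬ within L y := fun ⟨s, hs, h⟩ => by have := hy s hs; omega
        have n2 : ¬ within L y' := fun ⟨s, hs, h⟩ => by have := hnear s hs; omega
        simpa only [col, if_neg h2, if_neg h3, if_neg n1, if_neg n2] using h4
      rcases ih.2 with h | ⟨z, hz, h⟩
      · exact .inl (h.tail hgood)
      · exact .inr ⟨z, h1 ▸ hz, h.tail hgood⟩
  have hbound : ∀ x y, ReflTransGen r x y →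
      G.dist x y ≤ B ∨ ∃ s ∈ S (m (t y)), G.dist y s ≤ L + R' + B := by
    intro x y hxy
    rcases (hchain x y hxy).2 with h | ⟨z, ⟨s, hs, hzs⟩, h⟩
    · exact .inl (hc x y h)
    · refine .inr ⟨s, hs, ?_⟩
      have := hc z y h
      have := hG.dist_triangle (u := y) (v := z) (w := s)
      rw [G.dist_comm (u := y) (v := z)] at this
      omega
  refine ⟨2 * E + (2 * (L + R' + B) + D), col, fun x y hxy => ?_⟩
  have hρxy : ReflTransGen r (ρ x) (ρ y) := by
    refine ReflTransGen.lift ρ (fun a b hab => ?_) _ _ hxy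
    obtain ⟨a1, a2, a3, a4⟩ := hρ a
    obtain ⟨b1, b2, b3, b4⟩ := hρ b
    refine ⟨by rw [a1, b1, hstep a b hab.1 hab.2], a2, b2, by rw [a3, b3, hab.1], ?_⟩
    have h1 := hG.dist_triangle (u := ρ a) (v := a) (w := ρ b)
    have h2 := hG.dist_triangle (u := a) (v := b) (w := ρ b)
    rw [G.dist_comm (u := ρ a) (v := a)] at h1
    have := hab.2
    omega
  have hρyx : ReflTransGen r (ρ y) (ρ x) := by
    refine reflTransGen_symm (fun a b hab => ?_) hρxy
    obtain ⟨h1, h2, h3, h4, h5⟩ := hab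
    exact ⟨h1.symm, h3, h2, h4.symm, by rwa [G.dist_comm]⟩
  have hmain : G.dist (ρ x) (ρ y) ≤ 2 * (L + R' + B) + D := by
    rcases hbound _ _ hρxy with h | ⟨s, hs, h⟩
    · omega
    rcases hbound _ _ hρyx with h' | ⟨s', hs', h'⟩
    · rw [G.dist_comm]
      omega
    rw [(hchain _ _ hρxy).1] at hs'
    have h1 := hL.diam_le _ s' hs' s hs
    have h2 := hG.dist_triangle (u := ρ x) (v := s') (w := ρ y)
    have h3 := hG.dist_triangle (u := s') (v := s) (w := ρ y)
    rw [G.dist_comm (u := s) (v := ρ y)] at h3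
    omega
  have h1 := hG.dist_triangle (u := x) (v := ρ x) (w := y)
  have h2 := hG.dist_triangle (u := ρ x) (v := ρ y) (w := y)
  rw [G.dist_comm (u := ρ y) (v := y)] at h2
  have h3 := (hρ x).2.2.2
  have h4 := (hρ y).2.2.2
  omega

end RootedLayout

section TreeOfCopies

variable {N W : Type u}

theorem exists_adj_dist_lt {G : SimpleGraph N} (hG : G.Connected) {x y : N}
    (h : G.dist x y ≠ 0) : ∃ z, G.Adj x z ∧ G.dist z y < G.dist x y := by
  obtain ⟨q, hq⟩ := hG.exists_walk_length_eq_dist x y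
  cases q with
  | nil => exact absurd SimpleGraph.dist_self h
  | @cons _ z _ hxz q =>
    rw [SimpleGraph.Walk.length_cons] at hq
    have := SimpleGraph.dist_le q
    exact ⟨z, hxz, by omega⟩

/-- The structure of a tree rooted at `v`, given by depths and parents. -/
structure IsRooting (T : SimpleGraph N) (v : N) (depth : N → ℕ) (p : N → N) : Prop where
  depth_eq_zero : ∀ w, depth w = 0 ↔ w = v
  depth_parent : ∀ w, depth w ≠ 0 → depth w = depth (p w) + 1
  adj : ∀ a b, T.Adj a b → (p a = b ∧ depth a = depth b + 1) ∨ (p b = a ∧ depth b = depth a + 1)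

theorem exists_isRooting {T : SimpleGraph N} (hT : T.IsTree) (v : N) :
    ∃ depth p, IsRooting T v depth p := by
  classical
  have hpar : ∀ w, ∃ b, w ≠ v → T.Adj w b ∧ T.dist v w = T.dist v b + 1 := by
    intro w
    by_cases hw : w = v
    · exact ⟨w, fun h => absurd hw h⟩
    obtain ⟨b, h, hlt⟩ := exists_adj_dist_lt hT.connected (x := w) (y := v)
      (fun h => hw (hT.connected.dist_eq_zero_iff.mp h))
    refine ⟨b, fun _ => ⟨h, ?_⟩⟩
    rw [T.dist_comm, T.dist_comm (u := w)] at hlt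
    rcases hT.dist_eq_dist_add_one_of_adj v h with h2 | h2 <;> omega
  choose p hp using hpar
  have huniq : ∀ a b b', T.Adj a b → T.Adj a b' → T.dist v a = T.dist v b + 1 →
      T.dist v a = T.dist v b' + 1 → b = b' := by
    intro a b b' hb hb' hd hd'
    have key : ∀ c, T.Adj a c → T.dist v a = T.dist v c + 1 →
        ∃ q : T.Walk a v, q.IsPath ∧ q.snd = c := by
      intro c hc hd
      obtain ⟨q, hq, hl⟩ := hT.connected.exists_path_of_dist c v
      refine ⟨q.cons hc, ?_, by simp⟩
      refine SimpleGraph.Walk.isPath_of_length_eq_dist _ ?_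
      rw [SimpleGraph.Walk.length_cons, hl, T.dist_comm, ← hd, T.dist_comm]
    obtain ⟨q, hq, rfl⟩ := key b hb hd
    obtain ⟨q', hq', rfl⟩ := key b' hb' hd'
    rw [(hT.existsUnique_path a v).unique hq hq']
  have hstep : ∀ a b, T.Adj a b → T.dist v a = T.dist v b + 1 → p a = b := by
    intro a b hab hd
    have ha : a ≠ v := by
      rintro rfl
      rw [SimpleGraph.dist_self] at hd
      omega
    exact huniq a _ _ (hp a ha).1 hab (hp a ha).2 hd
  refine ⟨T.dist v, p, fun w => ?_, fun w hw => (hp w ?_).2, fun a b hab => ?_⟩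
  · rw [hT.connected.dist_eq_zero_iff]
    exact eq_comm
  · rintro rfl
    exact hw SimpleGraph.dist_self
  · rcases hT.dist_eq_dist_add_one_of_adj v hab with h | h
    · exact .inl ⟨hstep a b hab h, h⟩
    · exact .inr ⟨hstep b a hab.symm h, h⟩

/-- A disjoint union `C` of connected graphs, one for each node of a tree `T`, with bonds `Bd`
between the vertices of neighbouring graphs, such that all sets of attachment have diameter at
most `D`. -/
structure IsTreeOfCopies (T : SimpleGraph N) (node : W → N) (C Bd : SimpleGraph W) (D : ℕ) :
    Prop where
  isTree : T.IsTree
  bond_adj : ∀ a b, Bd.Adj a b → T.Adj (node a) (node b)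
  bond_unique : ∀ a b b', Bd.Adj a b → Bd.Adj a b' → node b = node b' → b = b'
  copy_node : ∀ a b, C.Adj a b → node a = node b
  copy_reachable : ∀ a b, node a = node b → C.Reachable a b
  diam_le : ∀ a b a' b', Bd.Adj a b → Bd.Adj a' b' → node a = node a' → node b = node b' →
    C.dist a a' ≤ D

section Quotient

variable {T : SimpleGraph N} {node : W → N} {C Bd : SimpleGraph W} {D : ℕ}

/-- The graph obtained from `C` by contracting all bonds. -/
abbrev contraction (C Bd : SimpleGraph W) : SimpleGraph Bd.ConnectedComponent :=
  (C ⊔ Bd).map Bd.connectedComponentMk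

theorem contraction_adj {x y : Bd.ConnectedComponent} (h : (contraction C Bd).Adj x y) :
    ∃ a b, C.Adj a b ∧ Bd.connectedComponentMk a = x ∧ Bd.connectedComponentMk b = y := by
  obtain ⟨hne, a, b, hab | hab, rfl, rfl⟩ := h
  · exact ⟨a, b, hab, rfl, rfl⟩
  · exact absurd (SimpleGraph.ConnectedComponent.connectedComponentMk_eq_of_adj hab) hne

theorem contraction_dist_le (hG : (contraction C Bd).Connected) {a b : W} (h : C.Reachable a b) :
    (contraction C Bd).dist (Bd.connectedComponentMk a) (Bd.connectedComponentMk b) ≤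
      C.dist a b := by
  obtain ⟨q, hq⟩ := h.exists_walk_length_eq_dist
  rw [← hq]
  clear hq h
  induction q with
  | nil => simp
  | @cons a b c hab q ih =>
    have h1 := hG.dist_triangle (u := Bd.connectedComponentMk a) (v := Bd.connectedComponentMk b)
      (w := Bd.connectedComponentMk c)
    have h2 : (contraction C Bd).dist (Bd.connectedComponentMk a)
        (Bd.connectedComponentMk b) ≤ 1 := by
      by_cases h : Bd.connectedComponentMk a = Bd.connectedComponentMk b
      · simp [h]
      · have hadj : (contraction C Bd).Adj (Bd.connectedComponentMk a)
            (Bd.connectedComponentMk b) := ⟨h, a, b, .inl hab, rfl, rfl⟩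
        exact (SimpleGraph.dist_eq_one_iff_adj.mpr hadj).le
    rw [SimpleGraph.Walk.length_cons]
    omega

/-- The vertex `b` is bonded to `a` and lies in the parent copy. -/
def IsUp (depth : N → ℕ) (node : W → N) (Bd : SimpleGraph W) (a b : W) : Prop :=
  Bd.Adj a b ∧ depth (node a) = depth (node b) + 1

/-- The set of contracted vertices through which the copy at `w` is attached to its parent. -/
def attachSet (depth : N → ℕ) (node : W → N) (Bd : SimpleGraph W) (w : N) :
    Set Bd.ConnectedComponent :=
  {x | ∃ a b, node a = w ∧ IsUp depth node Bd a b ∧ Bd.connectedComponentMk a = x}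

/-- `top x` is the representative of `x` closest to the root. -/
structure IsTopMap (depth : N → ℕ) (node : W → N) (Bd : SimpleGraph W)
    (top : Bd.ConnectedComponent → W) : Prop where
  mk_top : ∀ x, Bd.connectedComponentMk (top x) = x
  eq_of_not_up : ∀ a, (¬ ∃ b, IsUp depth node Bd a b) → top (Bd.connectedComponentMk a) = a

variable {v : N} {depth : N → ℕ} {p : N → N} {top : Bd.ConnectedComponent → W}

theorem IsUp.mk_eq {a b : W} (h : IsUp depth node Bd a b) :
    Bd.connectedComponentMk a = Bd.connectedComponentMk b :=
  SimpleGraph.ConnectedComponent.connectedComponentMk_eq_of_adj h.1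

theorem IsUp.parent (hC : IsTreeOfCopies T node C Bd D) (hv : IsRooting T v depth p) {a b : W}
    (h : IsUp depth node Bd a b) : p (node a) = node b := by
  rcases hv.adj _ _ (hC.bond_adj a b h.1) with h' | h'
  · exact h'.1
  · have := h.2
    omega

theorem IsTreeOfCopies.exists_isTopMap (hC : IsTreeOfCopies T node C Bd D)
    (hv : IsRooting T v depth p) : ∃ top, IsTopMap depth node Bd top := by
  classical
  have hup : ∀ a, ∃ b, (∃ b, IsUp depth node Bd a b) → IsUp depth node Bd a b := by
    intro a
    by_cases h : ∃ b, IsUp depth node Bd a b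
    · exact ⟨h.choose, fun _ => h.choose_spec⟩
    · exact ⟨a, fun h' => absurd h' h⟩
  choose up hup using hup
  let f : W → W := fun a => if ∃ b, IsUp depth node Bd a b then up a else a
  obtain ⟨τ, hτ⟩ := exists_recursive (fun a => depth (node a)) f (fun _ b => b) id
  have hτ_up : ∀ a b, IsUp depth node Bd a b → τ a = τ b := by
    intro a b hab
    have h1 := hup a ⟨b, hab⟩
    have hf : f a = up a := if_pos ⟨b, hab⟩
    have hb : up a = b := hC.bond_unique a _ _ h1.1 hab.1
      ((h1.parent hC hv).symm.trans (hab.parent hC hv))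
    rw [(hτ a).1 (by rw [hf]; have := h1.2; omega), hf, hb]
  have hτ_not : ∀ a, (¬ ∃ b, IsUp depth node Bd a b) → τ a = a := by
    intro a ha
    have hf : f a = a := if_neg ha
    exact (hτ a).2 (by rw [hf]; omega)
  have hadj : ∀ a b, Bd.Adj a b → τ a = τ b := by
    intro a b hab
    rcases hv.adj _ _ (hC.bond_adj a b hab) with h | h
    · exact hτ_up a b ⟨hab, h.2⟩
    · exact (hτ_up b a ⟨hab.symm, h.2⟩).symm
  have hτ_mk : ∀ a, Bd.connectedComponentMk (τ a) = Bd.connectedComponentMk a := by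
    intro a
    induction hk : depth (node a) using Nat.strong_induction_on generalizing a with
    | _ k ih =>
      by_cases h : ∃ b, IsUp depth node Bd a b
      · obtain ⟨b, hb⟩ := h
        rw [hτ_up a b hb, hb.mk_eq]
        exact ih _ (by have := hb.2; omega) b rfl
      · rw [hτ_not a h]
  have hwalk : ∀ a b (q : Bd.Walk a b), τ a = τ b := by
    intro a b q
    induction q with
    | nil => rfl
    | cons h _ ih => exact (hadj _ _ h).trans ih
  refine ⟨fun x => x.lift τ fun a b q _ => hwalk a b q, fun x => ?_, fun a ha => hτ_not a ha⟩
  induction x using SimpleGraph.ConnectedComponent.ind with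
  | h a => exact hτ_mk a

namespace IsTopMap

theorem top_eq_of_node (htop : IsTopMap depth node Bd top) (hv : IsRooting T v depth p) {a : W}
    (ha : node a = v) : top (Bd.connectedComponentMk a) = a := by
  refine htop.eq_of_not_up a ?_
  rintro ⟨b, -, hb⟩
  have := (hv.depth_eq_zero (node a)).mpr ha
  omega

theorem anc_node (htop : IsTopMap depth node Bd top) (hC : IsTreeOfCopies T node C Bd D)
    (hv : IsRooting T v depth p) (a : W) :
    Anc depth p (node (top (Bd.connectedComponentMk a))) (node a) := by
  induction hk : depth (node a) using Nat.strong_induction_on generalizing a with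
  | _ k ih =>
    by_cases h : ∃ b, IsUp depth node Bd a b
    · obtain ⟨b, hb⟩ := h
      rw [hb.mk_eq]
      exact .head ⟨hb.2, hb.parent hC hv⟩ (ih _ (by have := hb.2; omega) b rfl)
    · rw [htop.eq_of_not_up a h]
      exact .refl

theorem mem_attachSet (htop : IsTopMap depth node Bd top) (hC : IsTreeOfCopies T node C Bd D)
    (hv : IsRooting T v depth p) {w : N} (a : W) (hw : Anc depth p w (node a))
    (hw' : ¬ Anc depth p w (node (top (Bd.connectedComponentMk a)))) :
    Bd.connectedComponentMk a ∈ attachSet depth node Bd w := by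
  induction hk : depth (node a) using Nat.strong_induction_on generalizing a with
  | _ k ih =>
    by_cases h : ∃ b, IsUp depth node Bd a b
    · obtain ⟨b, hb⟩ := h
      rcases hw.eq_or_parent with rfl | ⟨-, hw1⟩
      · exact ⟨a, b, rfl, hb, rfl⟩
      · rw [hb.parent hC hv] at hw1
        rw [hb.mk_eq] at hw' ⊢
        exact ih _ (by have := hb.2; omega) b hw1 hw' rfl
    · rw [htop.eq_of_not_up a h] at hw'
      exact absurd hw hw'

theorem mem_attachSet_of_adj (htop : IsTopMap depth node Bd top)
    (hC : IsTreeOfCopies T node C Bd D) (hv : IsRooting T v depth p) {w : N}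
    {x y : Bd.ConnectedComponent} (hxy : (contraction C Bd).Adj x y)
    (hx : Anc depth p w (node (top x))) (hy : ¬ Anc depth p w (node (top y))) :
    y ∈ attachSet depth node Bd w := by
  obtain ⟨a, b, hab, rfl, rfl⟩ := contraction_adj hxy
  refine htop.mem_attachSet hC hv b ?_ hy
  rw [← hC.copy_node a b hab]
  exact hx.trans (htop.anc_node hC hv a)

theorem separates (htop : IsTopMap depth node Bd top)
    (hC : IsTreeOfCopies T node C Bd D) (hv : IsRooting T v depth p)
    (hG : (contraction C Bd).Connected) (w : N) (x y : Bd.ConnectedComponent)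
    (hx : Anc depth p w (node (top x))) (hy : ¬ Anc depth p w (node (top y))) :
    ∃ s ∈ attachSet depth node Bd w, (contraction C Bd).dist x s + (contraction C Bd).dist s y ≤
      (contraction C Bd).dist x y := by
  obtain ⟨q, hq⟩ := hG.exists_walk_length_eq_dist x y
  rw [← hq]
  clear hq
  induction q with
  | nil => exact absurd hx hy
  | @cons x x' y h q ih =>
    rw [SimpleGraph.Walk.length_cons]
    by_cases hx' : Anc depth p w (node (top x'))
    · obtain ⟨s, hs, hd⟩ := ih hx' hy
      refine ⟨s, hs, ?_⟩
      have h1 := hG.dist_triangle (u := x) (v := x') (w := s)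
      rw [SimpleGraph.dist_eq_one_iff_adj.mpr h] at h1
      omega
    · refine ⟨x', htop.mem_attachSet_of_adj hC hv h hx hx', ?_⟩
      rw [SimpleGraph.dist_eq_one_iff_adj.mpr h]
      have := SimpleGraph.dist_le q
      omega

theorem isRootedLayout (htop : IsTopMap depth node Bd top)
    (hC : IsTreeOfCopies T node C Bd D) (hv : IsRooting T v depth p)
    (hG : (contraction C Bd).Connected) :
    IsRootedLayout (contraction C Bd) depth p (fun x => node (top x)) (attachSet depth node Bd)
      D where
  depth_parent := hv.depth_parent
  root_empty := by
    intro w hw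
    refine Set.eq_empty_of_forall_notMem ?_
    rintro _ ⟨a, b, rfl, hab, rfl⟩
    have := hab.2
    omega
  mem_parent := by
    rintro w _ ⟨a, b, rfl, hab, rfl⟩
    rw [hab.mk_eq, hab.parent hC hv]
    by_cases h : ∃ c, IsUp depth node Bd b c
    · obtain ⟨c, hc⟩ := h
      exact .inr ⟨b, c, rfl, hc, rfl⟩
    · exact .inl (by rw [htop.eq_of_not_up b h])
  separates := htop.separates hC hv hG
  diam_le := by
    rintro w _ ⟨a, b, hw, hab, rfl⟩ _ ⟨a', b', hw', hab', rfl⟩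
    have haa : node a = node a' := hw.trans hw'.symm
    refine (contraction_dist_le hG (hC.copy_reachable a a' haa)).trans
      (hC.diam_le a b a' b' hab.1 hab'.1 haa ?_)
    rw [← hab.parent hC hv, ← hab'.parent hC hv, haa]

end IsTopMap

theorem exists_anc_depth_one (hv : IsRooting T v depth p) (u : N) (hu : u ≠ v) :
    ∃ w, depth w = 1 ∧ Anc depth p w u := by
  have hu0 : depth u ≠ 0 := fun h => hu ((hv.depth_eq_zero u).mp h)
  induction hk : depth u using Nat.strong_induction_on generalizing u with
  | _ k ih =>
    by_cases h1 : depth u = 1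
    · exact ⟨u, h1, .refl⟩
    · have hd := hv.depth_parent u hu0
      have h0 : depth (p u) ≠ 0 := by omega
      obtain ⟨w, hw, hwu⟩ := ih (depth (p u)) (by omega) (p u)
        (fun h => h0 ((hv.depth_eq_zero _).mpr h)) h0 rfl
      exact ⟨w, hw, .head ⟨hd, rfl⟩ hwu⟩

/-- The contraction distorts the metrics of the copies by a bounded factor only. -/
theorem IsTreeOfCopies.dist_le (hC : IsTreeOfCopies T node C Bd D)
    (hG : (contraction C Bd).Connected) (a b : W) (hab : node a = node b) :
    C.dist a b ≤ (D + 1) *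
      (contraction C Bd).dist (Bd.connectedComponentMk a) (Bd.connectedComponentMk b) := by
  obtain ⟨depth, p, hv⟩ := exists_isRooting hC.isTree (node b)
  obtain ⟨top, htop⟩ := hC.exists_isTopMap hv
  -- two vertices of the root copy that belong to the same attachment set
  have hattach : ∀ w a a', depth w = 1 → node a = node b → node a' = node b →
      Bd.connectedComponentMk a ∈ attachSet depth node Bd w →
      Bd.connectedComponentMk a' ∈ attachSet depth node Bd w → C.dist a a' ≤ D := by
    rintro w a a' hw ha ha' ⟨a₀, a₁, h1, h2, h3⟩ ⟨a₀', a₁', h1', h2', h3'⟩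
    have lift : ∀ a a₀ a₁, node a = node b → node a₀ = w → IsUp depth node Bd a₀ a₁ →
        Bd.connectedComponentMk a₀ = Bd.connectedComponentMk a → a₁ = a := by
      intro a a₀ a₁ ha h1 h2 h3
      have h0 : depth (node a₁) = 0 := by
        have := h2.2
        rw [h1] at this
        omega
      rw [← htop.top_eq_of_node hv ha, ← h3, h2.mk_eq,
        htop.top_eq_of_node hv ((hv.depth_eq_zero _).mp h0)]
    obtain rfl := lift a a₀ a₁ ha h1 h2 h3
    obtain rfl := lift a' a₀' a₁' ha' h1' h2' h3'
    exact hC.diam_le _ _ _ _ h2.1.symm h2'.1.symm (ha.trans ha'.symm) (h1.trans h1'.symm)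
  have hnot : ∀ w a, depth w = 1 → node a = node b →
      ¬ Anc depth p w (node (top (Bd.connectedComponentMk a))) := by
    intro w a hw ha h
    rw [htop.top_eq_of_node hv ha] at h
    have := h.depth_le
    have := (hv.depth_eq_zero (node a)).mpr ha
    omega
  have htri : ∀ a a', node a = node b → node a' = node b →
      C.dist a b ≤ C.dist a a' + C.dist a' b := by
    intro a a' ha ha'
    obtain ⟨q, hq⟩ := (hC.copy_reachable a a' (ha.trans ha'.symm)).exists_walk_length_eq_dist
    obtain ⟨q', hq'⟩ := (hC.copy_reachable a' b ha').exists_walk_length_eq_dist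
    rw [← hq, ← hq', ← SimpleGraph.Walk.length_append]
    exact SimpleGraph.dist_le _
  induction hk : (contraction C Bd).dist (Bd.connectedComponentMk a) (Bd.connectedComponentMk b)
    using Nat.strong_induction_on generalizing a with
  | _ k ih =>
    -- it suffices to find a vertex of the root copy that is closer to `b`
    have hred : ∀ a', node a' = node b → C.dist a a' ≤ D + 1 → (contraction C Bd).dist
        (Bd.connectedComponentMk a') (Bd.connectedComponentMk b) < k →
        C.dist a b ≤ (D + 1) * k := by
      intro a' ha' hd hlt
      have h1 := ih _ hlt a' ha' rfl
      have h2 := htri a a' hab ha'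
      have h3 := Nat.mul_le_mul_left (D + 1) (Nat.succ_le_of_lt hlt)
      rw [Nat.succ_eq_add_one, mul_add] at h3
      omega
    by_cases hk0 : k = 0
    · rw [hk0, hG.dist_eq_zero_iff] at hk
      have := htop.top_eq_of_node hv hab
      rw [hk, htop.top_eq_of_node hv rfl] at this
      rw [this]
      simp
    obtain ⟨x, hax, hxb⟩ := exists_adj_dist_lt hG (x := Bd.connectedComponentMk a)
      (y := Bd.connectedComponentMk b) (by omega)
    by_cases hx : node (top x) = node b
    · refine hred (top x) hx ?_ (by rw [htop.mk_top]; omega)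
      obtain ⟨a₁, a₂, h12, h1, h2⟩ := contraction_adj hax
      by_cases hn : node a₁ = node b
      · have e1 : a₁ = a := by
          rw [← htop.top_eq_of_node hv hn, h1, htop.top_eq_of_node hv hab]
        have e2 : a₂ = top x := by
          rw [← h2, htop.top_eq_of_node hv ((hC.copy_node _ _ h12).symm.trans hn)]
        rw [← e1, ← e2, SimpleGraph.dist_eq_one_iff_adj.mpr h12]
        omega
      · obtain ⟨w, hw, hwa⟩ := exists_anc_depth_one hv (node a₁) hn
        refine (hattach w a (top x) hw hab hx ?_ ?_).trans (Nat.le_succ D)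
        · rw [← h1]
          refine htop.mem_attachSet hC hv a₁ hwa ?_
          rw [h1]
          exact hnot w a hw hab
        · rw [htop.mk_top, ← h2]
          refine htop.mem_attachSet hC hv a₂ (by rwa [← hC.copy_node _ _ h12]) ?_
          rw [h2, ← htop.mk_top x]
          exact hnot w _ hw hx
    · obtain ⟨w, hw, hwx⟩ := exists_anc_depth_one hv _ hx
      obtain ⟨s, hs, hd⟩ := htop.separates hC hv hG w x _ hwx (hnot w b hw rfl)
      obtain ⟨c, c', h1, h2, h3⟩ := id hs
      have hc' : node c' = node b := by
        rw [← hv.depth_eq_zero]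
        have := h2.2
        rw [h1] at this
        omega
      have h4 : Bd.connectedComponentMk c' = s := h2.mk_eq.symm.trans h3
      refine hred c' hc' ?_ (by rw [h4]; omega)
      refine (hattach w a c' hw hab hc' ?_ (h4 ▸ hs)).trans (Nat.le_succ D)
      exact htop.mem_attachSet_of_adj hC hv hax.symm hwx (hnot w a hw hab)

theorem IsTreeOfCopies.colDimLE (hC : IsTreeOfCopies T node C Bd D)
    (hG : (contraction C Bd).Connected) {n : ℕ} (hn : 1 ≤ n)
    (hcol : ∀ R : ℕ, ∃ (B : ℕ) (c : W → Fin (n + 1)), ∀ a b,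
      ReflTransGen (fun a b => node a = node b ∧ c a = c b ∧ C.dist a b ≤ R) a b →
        C.dist a b ≤ B) :
    ColDimLE (contraction C Bd) n := by
  obtain ⟨depth, p, hv⟩ := exists_isRooting hC.isTree hC.isTree.connected.nonempty.some
  obtain ⟨top, htop⟩ := hC.exists_isTopMap hv
  refine (htop.isRootedLayout hC hv hG).colDimLE hG hn fun R => ?_
  obtain ⟨B, c, hc⟩ := hcol ((D + 1) * R)
  refine ⟨B, fun x => c (top x), fun x y hxy => ?_⟩
  have hnode : node (top x) = node (top y) := by
    induction hxy with
    | refl => rfl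
    | tail _ h ih => exact ih.trans h.1
  have h1 := contraction_dist_le hG (hC.copy_reachable _ _ hnode)
  rw [htop.mk_top, htop.mk_top] at h1
  refine h1.trans (hc _ _ (ReflTransGen.lift top (fun a b hab => ⟨hab.1, hab.2.1, ?_⟩) _ _ hxy))
  have h2 := hC.dist_le hG (top a) (top b) hab.1
  rw [htop.mk_top, htop.mk_top] at h2
  exact h2.trans (Nat.mul_le_mul_left _ hab.2.2)

end Quotient

end TreeOfCopies

/-- A locally finite family of finite sets that is invariant under a quasi-transitive group has
uniformly bounded diameters. -/
theorem exists_diam_le {V I : Type u} {G : SimpleGraph V} {Γ : Subgroup (G ≃g G)}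
    (hΓ : ActsQuasiTransitively Γ) (S : I → Set V) (hfin : ∀ k, (S k).Finite)
    (hloc : ∀ x, {k | x ∈ S k}.Finite)
    (hinv : ∀ γ ∈ Γ, ∃ σ : I → I, ∀ k, ∀ x ∈ S k, γ x ∈ S (σ k)) :
    ∃ D : ℕ, ∀ k, ∀ x ∈ S k, ∀ y ∈ S k, G.dist x y ≤ D := by
  obtain ⟨F, hF, horb⟩ := hΓ
  have hK : (⋃ f ∈ F, {k | f ∈ S k}).Finite := hF.biUnion fun f _ => hloc f
  have hP : (⋃ k ∈ ⋃ f ∈ F, {k | f ∈ S k}, (S k) ×ˢ (S k)).Finite :=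
    hK.biUnion fun k _ => (hfin k).prod (hfin k)
  obtain ⟨D, hD⟩ := (hP.image fun q => G.dist q.1 q.2).bddAbove
  refine ⟨D, fun k x hx y hy => ?_⟩
  obtain ⟨f, hf, γ, hγ, rfl⟩ := horb x
  obtain ⟨σ, hσ⟩ := hinv γ⁻¹ (Γ.inv_mem hγ)
  have hfS : f ∈ S (σ k) := by
    have := hσ k _ hx
    rwa [show γ⁻¹ (γ f) = f from γ.symm_apply_apply f] at this
  rw [← dist_iso γ⁻¹]
  rw [show γ⁻¹ (γ f) = f from γ.symm_apply_apply f]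
  refine hD ⟨(f, γ⁻¹ y), ?_, rfl⟩
  refine Set.mem_biUnion (x := σ k) ?_ ⟨hfS, hσ k y hy⟩
  exact Set.mem_biUnion hf hfS

theorem RespectsGroup.exists_map {V W I J : Type u} {G : SimpleGraph V} {H : SimpleGraph W}
    {S : I → Set V} {R : J → Set W} {φ : ∀ k ℓ, S k ≃ R ℓ} {Γ : Subgroup (G ≃g G)}
    {Δ : Subgroup (H ≃g H)} (h : RespectsGroup φ Γ Δ) :
    ∀ γ ∈ Γ, ∃ σ : I → I, ∀ k, ∀ x ∈ S k, γ x ∈ S (σ k) := by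
  intro γ hγ
  obtain ⟨σ, hσ⟩ := h γ hγ
  refine ⟨σ, fun k x hx => ?_⟩
  obtain ⟨ℓ, τ, -, -, h⟩ := hσ k
  exact (h ⟨x, hx⟩).1

namespace TreeAmalgam

variable {V₁ V₂ : Type u} {G₁ : SimpleGraph V₁} {G₂ : SimpleGraph V₂} (A : TreeAmalgam G₁ G₂)

theorem copies_adj_inl {u u' : A.T₁} {x y : V₁} :
    A.copies.Adj (Sum.inl (u, x)) (Sum.inl (u', y)) ↔ u = u' ∧ G₁.Adj x y := by
  rw [copies, SimpleGraph.fromRel_adj]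
  constructor
  · rintro ⟨-, h | h⟩
    · cases h with | left _ _ _ h => exact ⟨rfl, h⟩
    · cases h with | left _ _ _ h => exact ⟨rfl, h.symm⟩
  · rintro ⟨rfl, h⟩
    refine ⟨fun he => h.ne ?_, .inl (.left u x y h)⟩
    simpa using he

theorem copies_adj_inr {v v' : A.T₂} {x y : V₂} :
    A.copies.Adj (Sum.inr (v, x)) (Sum.inr (v', y)) ↔ v = v' ∧ G₂.Adj x y := by
  rw [copies, SimpleGraph.fromRel_adj]
  constructor
  · rintro ⟨-, h | h⟩
    · cases h with | right _ _ _ h => exact ⟨rfl, h⟩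
    · cases h with | right _ _ _ h => exact ⟨rfl, h.symm⟩
  · rintro ⟨rfl, h⟩
    refine ⟨fun he => h.ne ?_, .inl (.right v x y h)⟩
    simpa using he

theorem node_eq_of_copies_adj {a b : A.Vert} (h : A.copies.Adj a b) : A.node a = A.node b := by
  rw [copies, SimpleGraph.fromRel_adj] at h
  rcases h with ⟨-, h | h⟩ <;> cases h <;> rfl

theorem copies_edist_inl (u : A.T₁) (x y : V₁) :
    A.copies.edist (Sum.inl (u, x)) (Sum.inl (u, y)) = G₁.edist x y := by
  refine le_antisymm ?_ ?_
  · let f : G₁ →g A.copies := ⟨fun x => Sum.inl (u, x), fun h => A.copies_adj_inl.mpr ⟨rfl, h⟩⟩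
    exact edist_map_le f x y
  · refine le_iInf fun q => ?_
    have key : ∀ a b (q : A.copies.Walk a b), ∀ x y, a = Sum.inl (u, x) → b = Sum.inl (u, y) →
        G₁.edist x y ≤ q.length := by
      intro a b q
      induction q with
      | nil =>
        rintro x y rfl h
        obtain rfl : x = y := by simpa using h
        simp
      | @cons a b c h q ih =>
        rintro x y rfl hc
        have hn := A.node_eq_of_copies_adj h
        rcases b with ⟨u', z⟩ | ⟨v, z⟩
        · obtain ⟨rfl, hadj⟩ := A.copies_adj_inl.mp h
          have h1 := ih z y rfl hc
          have h2 := SimpleGraph.edist_triangle (G := G₁) (u := x) (v := z) (w := y)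
          rw [SimpleGraph.edist_eq_one_iff_adj.mpr hadj] at h2
          rw [SimpleGraph.Walk.length_cons]
          push_cast
          rw [add_comm]
          exact h2.trans (by gcongr)
        · simp [node] at hn
    exact key _ _ q x y rfl rfl

theorem copies_edist_inr (v : A.T₂) (x y : V₂) :
    A.copies.edist (Sum.inr (v, x)) (Sum.inr (v, y)) = G₂.edist x y := by
  refine le_antisymm ?_ ?_
  · let f : G₂ →g A.copies := ⟨fun x => Sum.inr (v, x), fun h => A.copies_adj_inr.mpr ⟨rfl, h⟩⟩
    exact edist_map_le f x y
  · refine le_iInf fun q => ?_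
    have key : ∀ a b (q : A.copies.Walk a b), ∀ x y, a = Sum.inr (v, x) → b = Sum.inr (v, y) →
        G₂.edist x y ≤ q.length := by
      intro a b q
      induction q with
      | nil =>
        rintro x y rfl h
        obtain rfl : x = y := by simpa using h
        simp
      | @cons a b c h q ih =>
        rintro x y rfl hc
        have hn := A.node_eq_of_copies_adj h
        rcases b with ⟨u, z⟩ | ⟨v', z⟩
        · simp [node] at hn
        · obtain ⟨rfl, hadj⟩ := A.copies_adj_inr.mp h
          have h1 := ih z y rfl hc
          have h2 := SimpleGraph.edist_triangle (G := G₂) (u := x) (v := z) (w := y)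
          rw [SimpleGraph.edist_eq_one_iff_adj.mpr hadj] at h2
          rw [SimpleGraph.Walk.length_cons]
          push_cast
          rw [add_comm]
          exact h2.trans (by gcongr)
    exact key _ _ q x y rfl rfl

theorem copies_dist_inl (u : A.T₁) (x y : V₁) :
    A.copies.dist (Sum.inl (u, x)) (Sum.inl (u, y)) = G₁.dist x y :=
  congrArg ENat.toNat (A.copies_edist_inl u x y)

theorem copies_dist_inr (v : A.T₂) (x y : V₂) :
    A.copies.dist (Sum.inr (v, x)) (Sum.inr (v, y)) = G₂.dist x y :=
  congrArg ENat.toNat (A.copies_edist_inr v x y)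

theorem bondRel_iff {u : A.T₁} {v : A.T₂} {x : V₁} {y : V₂} :
    A.BondRel (Sum.inl (u, x)) (Sum.inr (v, y)) ↔
      ∃ (h : A.tree.Adj (Sum.inl u) (Sum.inr v)) (hx : x ∈ A.S₁ (A.label₁ u ⟨v, h⟩)),
        (A.φ (A.label₁ u ⟨v, h⟩) (A.label₂ v ⟨u, h⟩) ⟨x, hx⟩ : V₂) = y := by
  constructor
  · rintro ⟨_, _, h, x⟩
    exact ⟨h, x.2, rfl⟩
  · rintro ⟨h, hx, rfl⟩
    exact .mk u v h ⟨x, hx⟩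

theorem bonds_adj_iff {a b : A.Vert} : A.bonds.Adj a b ↔ A.BondRel a b ∨ A.BondRel b a := by
  rw [bonds, SimpleGraph.fromRel_adj, and_iff_right_iff_imp]
  rintro (h | h) <;> cases h <;> simp

theorem bonds_adj_inl_inr {u : A.T₁} {v : A.T₂} {x : V₁} {y : V₂} :
    A.bonds.Adj (Sum.inl (u, x)) (Sum.inr (v, y)) ↔
      A.BondRel (Sum.inl (u, x)) (Sum.inr (v, y)) := by
  rw [bonds_adj_iff]
  exact or_iff_left fun h => by cases h

theorem bonds_not_adj_inl_inl (a b : A.T₁ × V₁) : ¬ A.bonds.Adj (Sum.inl a) (Sum.inl b) := by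
  rw [bonds_adj_iff]
  rintro (h | h) <;> cases h

theorem bonds_not_adj_inr_inr (a b : A.T₂ × V₂) : ¬ A.bonds.Adj (Sum.inr a) (Sum.inr b) := by
  rw [bonds_adj_iff]
  rintro (h | h) <;> cases h

theorem mem_S₂_of_bondRel {u : A.T₁} {v : A.T₂} {x : V₁} {y : V₂}
    (h : A.BondRel (Sum.inl (u, x)) (Sum.inr (v, y))) :
    ∃ h : A.tree.Adj (Sum.inl u) (Sum.inr v), y ∈ A.S₂ (A.label₂ v ⟨u, h⟩) := by
  obtain ⟨hadj, hx, rfl⟩ := A.bondRel_iff.mp h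
  exact ⟨hadj, Subtype.coe_prop _⟩

theorem finite_labels₁ (hA : A.FiniteIdentification) (u : A.T₁) (x : V₁) :
    {k | x ∈ A.S₁ k}.Finite := by
  obtain ⟨N, hN⟩ := hA
  have hfin : (A.nodesOf (A.π (Sum.inl (u, x)))).Finite :=
    Set.finite_of_encard_le_coe (hN _)
  refine Set.Finite.of_injOn (f := fun k => Sum.inr ((A.label₁ u).symm k).1) (fun k hk => ?_)
    (fun k _ k' _ h => ?_) hfin
  · set v := (A.label₁ u).symm k with hv
    have hk' : A.label₁ u ⟨v.1, v.2⟩ = k := by simp [hv]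
    have hx : x ∈ A.S₁ (A.label₁ u ⟨v.1, v.2⟩) := by rw [hk']; exact hk
    refine ⟨Sum.inr (v.1, (A.φ _ (A.label₂ v.1 ⟨u, v.2⟩) ⟨x, hx⟩ : V₂)), ?_, rfl⟩
    refine (SimpleGraph.ConnectedComponent.connectedComponentMk_eq_of_adj ?_).symm
    exact A.bonds_adj_inl_inr.mpr (.mk u v.1 v.2 ⟨x, hx⟩)
  · exact (A.label₁ u).symm.injective (Subtype.ext (by simpa using h))

theorem finite_labels₂ (hA : A.FiniteIdentification) (v : A.T₂) (y : V₂) :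
    {ℓ | y ∈ A.S₂ ℓ}.Finite := by
  obtain ⟨N, hN⟩ := hA
  have hfin : (A.nodesOf (A.π (Sum.inr (v, y)))).Finite :=
    Set.finite_of_encard_le_coe (hN _)
  refine Set.Finite.of_injOn (f := fun ℓ => Sum.inl ((A.label₂ v).symm ℓ).1) (fun ℓ hℓ => ?_)
    (fun k _ k' _ h => ?_) hfin
  · set u := (A.label₂ v).symm ℓ with hu
    have hℓ' : A.label₂ v ⟨u.1, u.2⟩ = ℓ := by simp [hu]
    have hy : y ∈ A.S₂ (A.label₂ v ⟨u.1, u.2⟩) := by rw [hℓ']; exact hℓ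
    let x := (A.φ (A.label₁ u.1 ⟨v, u.2⟩) (A.label₂ v ⟨u.1, u.2⟩)).symm ⟨y, hy⟩
    have hb : A.BondRel (Sum.inl (u.1, (x : V₁))) (Sum.inr (v, y)) :=
      A.bondRel_iff.mpr ⟨u.2, x.2, by simp [x]⟩
    exact ⟨Sum.inl (u.1, (x : V₁)),
      SimpleGraph.ConnectedComponent.connectedComponentMk_eq_of_adj
        (A.bonds_adj_inl_inr.mpr hb), rfl⟩
  · exact (A.label₂ v).symm.injective (Subtype.ext (by simpa using h))

theorem exists_isTreeOfCopies (h₁ : G₁.Connected) (h₂ : G₂.Connected) (hfin : A.FiniteAdhesion)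
    (hid : A.FiniteIdentification) {Γ₁ : Subgroup (G₁ ≃g G₁)} {Γ₂ : Subgroup (G₂ ≃g G₂)}
    (hΓ₁ : ActsQuasiTransitively Γ₁) (hΓ₂ : ActsQuasiTransitively Γ₂)
    (hresp : A.RespectsGroups Γ₁ Γ₂) :
    ∃ D, IsTreeOfCopies A.tree A.node A.copies A.bonds D := by
  have hD₁ : ∃ D : ℕ, A.T₁ → ∀ k, ∀ x ∈ A.S₁ k, ∀ y ∈ A.S₁ k, G₁.dist x y ≤ D := by
    rcases isEmpty_or_nonempty A.T₁ with h | ⟨⟨u⟩⟩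
    · exact ⟨0, fun u => h.elim u⟩
    · obtain ⟨D, hD⟩ := exists_diam_le hΓ₁ A.S₁ hfin.1 (A.finite_labels₁ hid u)
        hresp.1.exists_map
      exact ⟨D, fun _ => hD⟩
  have hD₂ : ∃ D : ℕ, A.T₂ → ∀ ℓ, ∀ x ∈ A.S₂ ℓ, ∀ y ∈ A.S₂ ℓ, G₂.dist x y ≤ D := by
    rcases isEmpty_or_nonempty A.T₂ with h | ⟨⟨v⟩⟩
    · exact ⟨0, fun v => h.elim v⟩
    · obtain ⟨D, hD⟩ := exists_diam_le hΓ₂ A.S₂ hfin.2 (A.finite_labels₂ hid v)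
        hresp.2.exists_map
      exact ⟨D, fun _ => hD⟩
  obtain ⟨D₁, hD₁⟩ := hD₁
  obtain ⟨D₂, hD₂⟩ := hD₂
  refine ⟨max D₁ D₂, A.isTree, ?_, ?_, fun a b => A.node_eq_of_copies_adj, ?_, ?_⟩
  · rintro (⟨u, x⟩ | ⟨v, y⟩) (⟨u', x'⟩ | ⟨v', y'⟩) h
    · exact absurd h (A.bonds_not_adj_inl_inl _ _)
    · exact (A.bondRel_iff.mp (A.bonds_adj_inl_inr.mp h)).1
    · exact (A.bondRel_iff.mp (A.bonds_adj_inl_inr.mp h.symm)).1.symm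
    · exact absurd h (A.bonds_not_adj_inr_inr _ _)
  · rintro (⟨u, x⟩ | ⟨v, y⟩) (⟨u', x'⟩ | ⟨v', y'⟩) (⟨u'', x''⟩ | ⟨v'', y''⟩) h h' hn
    all_goals first
      | exact absurd h (A.bonds_not_adj_inl_inl _ _)
      | exact absurd h (A.bonds_not_adj_inr_inr _ _)
      | exact absurd h' (A.bonds_not_adj_inl_inl _ _)
      | exact absurd h' (A.bonds_not_adj_inr_inr _ _)
      | skip
    · obtain rfl : v' = v'' := by simpa [node] using hn
      obtain ⟨_, _, rfl⟩ := A.bondRel_iff.mp (A.bonds_adj_inl_inr.mp h)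
      obtain ⟨_, _, rfl⟩ := A.bondRel_iff.mp (A.bonds_adj_inl_inr.mp h')
      rfl
    · obtain rfl : u' = u'' := by simpa [node] using hn
      obtain ⟨_, hx, he⟩ := A.bondRel_iff.mp (A.bonds_adj_inl_inr.mp h.symm)
      obtain ⟨_, hx', he'⟩ := A.bondRel_iff.mp (A.bonds_adj_inl_inr.mp h'.symm)
      have := (A.φ _ _).injective (Subtype.ext (he.trans he'.symm))
      rw [Subtype.mk.injEq] at this
      rw [this]
  · rintro (⟨u, x⟩ | ⟨v, y⟩) (⟨u', x'⟩ | ⟨v', y'⟩) hn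
    · obtain rfl : u = u' := by simpa [node] using hn
      rw [← SimpleGraph.edist_ne_top_iff_reachable, copies_edist_inl,
        SimpleGraph.edist_ne_top_iff_reachable]
      exact h₁ x x'
    · simp [node] at hn
    · simp [node] at hn
    · obtain rfl : v = v' := by simpa [node] using hn
      rw [← SimpleGraph.edist_ne_top_iff_reachable, copies_edist_inr,
        SimpleGraph.edist_ne_top_iff_reachable]
      exact h₂ y y'
  · rintro (⟨u, x⟩ | ⟨v, y⟩) (⟨u', x'⟩ | ⟨v', y'⟩) (⟨w, z⟩ | ⟨w, z⟩) (⟨w', z'⟩ | ⟨w', z'⟩)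
      h h' hn hn'
    all_goals first
      | exact absurd h (A.bonds_not_adj_inl_inl _ _)
      | exact absurd h (A.bonds_not_adj_inr_inr _ _)
      | exact absurd h' (A.bonds_not_adj_inl_inl _ _)
      | exact absurd h' (A.bonds_not_adj_inr_inr _ _)
      | exact absurd hn Sum.inl_ne_inr
      | exact absurd hn Sum.inr_ne_inl
      | skip
    · obtain rfl : u = w := by simpa [node] using hn
      obtain rfl : v' = w' := by simpa [node] using hn'
      rw [copies_dist_inl]
      obtain ⟨_, hx, -⟩ := A.bondRel_iff.mp (A.bonds_adj_inl_inr.mp h)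
      obtain ⟨_, hx', -⟩ := A.bondRel_iff.mp (A.bonds_adj_inl_inr.mp h')
      exact (hD₁ u _ _ hx _ hx').trans (le_max_left _ _)
    · obtain rfl : v = w := by simpa [node] using hn
      obtain rfl : u' = w' := by simpa [node] using hn'
      rw [copies_dist_inr]
      obtain ⟨_, hx⟩ := A.mem_S₂_of_bondRel (A.bonds_adj_inl_inr.mp h.symm)
      obtain ⟨_, hx'⟩ := A.mem_S₂_of_bondRel (A.bonds_adj_inl_inr.mp h'.symm)
      exact (hD₂ v _ _ hx _ hx').trans (le_max_right _ _)

theorem exists_colouring_copies {n : ℕ} (h₁ : ColDimLE G₁ n) (h₂ : ColDimLE G₂ n) (R : ℕ) :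
    ∃ (B : ℕ) (c : A.Vert → Fin (n + 1)), ∀ a b, ReflTransGen
      (fun a b => A.node a = A.node b ∧ c a = c b ∧ A.copies.dist a b ≤ R) a b →
        A.copies.dist a b ≤ B := by
  obtain ⟨B₁, c₁, hc₁⟩ := h₁ R
  obtain ⟨B₂, c₂, hc₂⟩ := h₂ R
  refine ⟨max B₁ B₂, Sum.elim (fun q => c₁ q.2) (fun q => c₂ q.2), fun a b hab => ?_⟩
  rcases a with ⟨u, x⟩ | ⟨v, x⟩
  · have key : ∃ y, b = Sum.inl (u, y) ∧
        ReflTransGen (fun a b => c₁ a = c₁ b ∧ G₁.dist a b ≤ R) x y := by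
      induction hab with
      | refl => exact ⟨x, rfl, .refl⟩
      | @tail b d _ hbd ih =>
        obtain ⟨y, rfl, hy⟩ := ih
        obtain ⟨hn, hc, hd⟩ := hbd
        rcases d with ⟨u', z⟩ | ⟨v, z⟩
        · obtain rfl : u = u' := by simpa [node] using hn
          rw [copies_dist_inl] at hd
          exact ⟨z, rfl, hy.tail ⟨hc, hd⟩⟩
        · simp [node] at hn
    obtain ⟨y, rfl, hy⟩ := key
    rw [copies_dist_inl]
    exact (hc₁ x y hy).trans (le_max_left _ _)
  · have key : ∃ y, b = Sum.inr (v, y) ∧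
        ReflTransGen (fun a b => c₂ a = c₂ b ∧ G₂.dist a b ≤ R) x y := by
      induction hab with
      | refl => exact ⟨x, rfl, .refl⟩
      | @tail b d _ hbd ih =>
        obtain ⟨y, rfl, hy⟩ := ih
        obtain ⟨hn, hc, hd⟩ := hbd
        rcases d with ⟨u, z⟩ | ⟨v', z⟩
        · simp [node] at hn
        · obtain rfl : v = v' := by simpa [node] using hn
          rw [copies_dist_inr] at hd
          exact ⟨z, rfl, hy.tail ⟨hc, hd⟩⟩
    obtain ⟨y, rfl, hy⟩ := key
    rw [copies_dist_inr]
    exact (hc₂ x y hy).trans (le_max_right _ _)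

end TreeAmalgam

theorem IsAmalgamOf.colDimLE {G G₁ G₂ : QTGraph.{u}} (h : IsAmalgamOf G G₁ G₂) {n : ℕ}
    (hn : 1 ≤ n) (h₁ : ColDimLE G₁.graph n) (h₂ : ColDimLE G₂.graph n) : ColDimLE G.graph n := by
  obtain ⟨A, -, hfin, hid, ⟨Γ₁, Γ₂, hΓ₁, hΓ₂, hresp⟩, ⟨e⟩⟩ := h
  have hgroups : A.RespectsGroups Γ₁ Γ₂ := by
    rcases hresp with h | ⟨_, _, _, _, _, h, _⟩
    · exact h.1
    · exact h
  obtain ⟨D, hC⟩ := A.exists_isTreeOfCopies G₁.connected G₂.connected hfin hid hΓ₁ hΓ₂ hgroups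
  have hconn : A.graph.Connected := e.connected_iff.mp G.connected
  exact ColDimLE.of_iso e (hC.colDimLE hconn hn (A.exists_colouring_copies h₁ h₂))

theorem IsFactorisation.colDimLE {L : List QTGraph.{u}} {G : QTGraph.{u}}
    (h : IsFactorisation L G) {n : ℕ} (hn : 1 ≤ n) (hL : ∀ H ∈ L, ColDimLE H.graph n) :
    ColDimLE G.graph n := by
  induction h with
  | single G₁ G h =>
    obtain ⟨e⟩ := h
    exact (hL G₁ (by simp)).of_iso e
  | amalgam L₁ L₂ G₁ G₂ G _ _ h ih₁ ih₂ =>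
    exact h.colDimLE hn (ih₁ fun H hH => hL H (by simp [hH]))
      (ih₂ fun H hH => hL H (by simp [hH]))
  | perm L L' G hLL' _ ih => exact ih fun H hH => hL H (hLL'.mem_iff.mp hH)

end TreeAmalg

theorem theorem2 (n : ℕ) (F : Fin n → TreeAmalg.QTGraph.{u}) (G : TreeAmalg.QTGraph.{u})
    (h : TreeAmalg.IsFactorisation (List.ofFn F) G) :
    G.asdim ≤ max 1 (⨆ i, (F i).asdim) := by
  rcases eq_or_ne (max 1 (⨆ i, (F i).asdim)) ⊤ with htop | htop
  · rw [htop]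
    exact le_top
  obtain ⟨m, hm⟩ := ENat.ne_top_iff_exists.mp htop
  rw [← hm]
  refine TreeAmalg.asdim_le_of_colDimLE (h.colDimLE ?_ fun H hH => ?_)
  · have : (1 : ℕ∞) ≤ m := hm ▸ le_max_left _ _
    exact_mod_cast this
  · obtain ⟨i, rfl⟩ := (List.mem_ofFn' F H).mp hH
    refine TreeAmalg.ColDimLE.of_asdim_le ?_
    rw [hm]
    exact (le_iSup (fun i => (F i).asdim) i).trans (le_max_right _ _)
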